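/- **Setting.** Let $\sigma:\mathbb R\to\mathbb R$ be $C^2$ with $\|\sigma'\|_\infty,\|\sigma''\|_\infty<\infty$ and let $M\in\mathbb R$. For $m,d$ with $m\ge 1$ consider the network $$f(x;\theta)=\frac1{\sqrt m}\sum_{\ell=1}^m a_\ell\,\sigma(\langle w_\ell,x\rangle+b_\ell)+b_0,\qquad x\in\mathbb R^d,$$ with parameters $\theta=(a,W,b,b_0)\in\mathbb R^p$, $p=md+2m+1$, where $w_\ell$ is the $\ell$-th row of $W\in\mathbb R^{m\times d}$. Let $X\subset\mathbb R^d$ be compact with $\|x\|_2\le M$ for $x\in X$, let $\rho$ be a strictly positive Borel probability measure on $X$, and let $f^*\in L^\infty(X,\rho)$. Fix a deterministic $\theta_0\in\mathbb R^p$. For $n\geq 1$ i.i.d. samples $x_1,\dots,x_n\sim\rho$ let $\theta_t$, $t\ge0$, be the gradient flow $\partial_t\theta_t=-\nabla\Phi(\theta_t)$ from $\theta_0$ of $\Phi(\theta)=\frac12\|\hat r(\theta)\|_{\mathbb R^n}^2$, where $\|\hat r(\theta)\|^2_{\mathbb R^n}=\frac1n\sum_{i=1}^n(f(x_i;\theta)-f^*(x_i))^2$.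 Put $\hat r_0=\hat r(\theta_0)$, $f_0=f(\cdot;\theta_0)$ and $r_t=f(\cdot;\theta_t)-f^*\in L^2(X,\rho)$; $\|\cdot\|_2$ applied to functions is the norm of $L^2(X,\rho)$, and $\|f^*\|_\infty,\|f_0\|_\infty$ are norms in $L^\infty(X,\rho)$. Let $$K_0(x,x')=\langle\partial_\theta f(x;\theta_0),\partial_\theta f(x';\theta_0)\rangle,\qquad T_{K_0}h(x)=\int_X K_0(x,s)h(s)\,d\rho(s)\ \text{ on } L^2(X,\rho),$$ let $\kappa=\max_{x\in X}K_0(x,x)$, let $\sigma_1\ge\sigma_2\ge\cdots$ be the nonzero eigenvalues of $T_{K_0}$ with multiplicity (finitely many, since $T_{K_0}$ has rank at most $p$) with orthonormal eigenfunctions $\phi_1,\phi_2,\dots$, and let $P_k$ be the orthogonal projection onto $\mathrm{span}\{\phi_1,\dots,\phi_k\}$. Put $$D=3\max\{|\sigma(0)|,\,M\|\sigma'\|_\infty,\,\|\sigma'\|_\infty,\,1\},\qquad \xi(0)=\max\Big\{\tfrac{\|W(0)\|_{op}}{\sqrt m},\tfrac{\|b(0)\|_2}{\sqrt m},\tfrac{\|a(0)\|_2}{\sqrt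 m},1\Big\},$$ $$\tilde\xi(0)=\max\Big\{\max_\ell\|w_\ell(0)\|_2,\|a(0)\|_\infty,\|b(0)\|_\infty,1\Big\}.$$ **Theorem.** There is a constant $C>0$ depending only on $\sigma$ and $M$ such that, in every such setting, for all $T>0$ and $\delta\in(0,1)$ with $$m\ \ge\ D^2\big[\|f^*\|_\infty+\|f_0\|_\infty\big]^2T^2,$$ and with $S=[\|f^*\|_\infty+\|f_0\|_\infty]\,[1+T\xi(0)^2]$, the following holds with probability at least $1-\delta$ over the sampling of $x_1,\dots,x_n$: for all $t\in[0,T]$ and all $k\geq 1$ not exceeding the number of nonzero eigenvalues of $T_{K_0}$ (counted with multiplicity), $$\big\|P_k\big(r_t-e^{-T_{K_0}t}r_0\big)\big\|_2\ \le\ \frac{1-e^{-\sigma_kt}}{\sigma_k}\,E(t)\qquad\text{and}\qquad \big\|r_t-e^{-T_{K_0}t}r_0\big\|_2\ \le\ t\,E(t),$$ where $$E(t)=C\,\log\!\Big(\frac{e\,n\,p\,\xi(0)}{\delta}\Big)\left[\frac{t}{\sqrt m}\,\xi(0)^2\,\tilde\xi(0)\,\|\hat r_0\|_{\mathbb R^n}^2+\frac{S\sqrt{\sigma_1\kappa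 p}}{\sqrt n}\right].$$ -/

import Mathlib

open MeasureTheory Set
open scoped ENNReal

noncomputable section

namespace ShallowNTK

/-- Inputs: `ℝ^d` with the Euclidean norm. -/
abbrev Input (d : ℕ) : Type := EuclideanSpace ℝ (Fin d)

/-- Index set of the coordinates of `θ = (a, vec W, b, b₀)`. -/
abbrev ParamIndex (m d : ℕ) : Type := Fin m ⊕ (Fin m × Fin d) ⊕ Fin m ⊕ Unit

/-- The parameter space `ℝ^p` with the Euclidean inner product. -/
abbrev Params (m d : ℕ) : Type := EuclideanSpace ℝ (ParamIndex m d)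

/-- The number of parameters `p = md + 2m + 1`. -/
def numParams (m d : ℕ) : ℕ := m * d + 2 * m + 1

theorem card_paramIndex (m d : ℕ) : Fintype.card (ParamIndex m d) = numParams m d := by
  simp [ParamIndex, numParams]
  ring

variable {m d : ℕ}

/-- Output weights `a ∈ ℝ^m`. -/
def outerWeights (θ : Params m d) : EuclideanSpace ℝ (Fin m) :=
  WithLp.toLp 2 fun ℓ => θ (Sum.inl ℓ)

/-- Hidden weights `W ∈ ℝ^{m × d}`. -/
def innerWeights (θ : Params m d) : Matrix (Fin m) (Fin d) ℝ :=
  Matrix.of fun ℓ j => θ (Sum.inr (Sum.inl (ℓ, j)))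

/-- The row `w_ℓ` of `W`. -/
def weightRow (θ : Params m d) (ℓ : Fin m) : Input d :=
  WithLp.toLp 2 (innerWeights θ ℓ)

/-- Hidden biases `b ∈ ℝ^m`. -/
def innerBias (θ : Params m d) : EuclideanSpace ℝ (Fin m) :=
  WithLp.toLp 2 fun ℓ => θ (Sum.inr (Sum.inr (Sum.inl ℓ)))

/-- Output bias `b₀ ∈ ℝ`. -/
def outerBias (θ : Params m d) : ℝ := θ (Sum.inr (Sum.inr (Sum.inr ())))

/-- The shallow network
`f(x; θ) = m^{-1/2} ∑_ℓ a_ℓ σ(⟨w_ℓ, x⟩ + b_ℓ) + b₀`. -/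
def network (σ : ℝ → ℝ) (θ : Params m d) (x : Input d) : ℝ :=
  (1 / Real.sqrt m) *
    ∑ ℓ, outerWeights θ ℓ * σ (inner ℝ (weightRow θ ℓ) x + innerBias θ ℓ) + outerBias θ

/-- The neural tangent kernel at the parameter `θ`,
`K_θ(x, x') = ⟨∂_θ f(x; θ), ∂_θ f(x'; θ)⟩`. -/
def ntk (σ : ℝ → ℝ) (θ : Params m d) (x x' : Input d) : ℝ :=
  inner ℝ (gradient (fun η : Params m d => network σ η x) θ)
    (gradient (fun η : Params m d => network σ η x') θ)

/-- The squared norm `‖r̂(θ)‖²_{ℝⁿ} = n⁻¹ ∑ᵢ (f(xᵢ; θ) - f*(xᵢ))²` of the training residual. -/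
def empResidualSq {X : Set (Input d)} (σ : ℝ → ℝ) (fstar : X → ℝ) {n : ℕ} (x : Fin n → X)
    (θ : Params m d) : ℝ :=
  (1 / (n : ℝ)) * ∑ i, (network σ θ (x i : Input d) - fstar (x i)) ^ 2

/-- The training loss `Φ(θ) = ½ ‖r̂(θ)‖²_{ℝⁿ}`. -/
def loss {X : Set (Input d)} (σ : ℝ → ℝ) (fstar : X → ℝ) {n : ℕ} (x : Fin n → X)
    (θ : Params m d) : ℝ :=
  (1 / 2) * empResidualSq σ fstar x θ

/-- `t ↦ θ t`, `t ≥ 0`, is the gradient flow of the training loss started at `θ₀`. -/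
structure IsGradientFlow {X : Set (Input d)} (σ : ℝ → ℝ) (fstar : X → ℝ) {n : ℕ}
    (x : Fin n → X) (θ₀ : Params m d) (θ : ℝ → Params m d) : Prop where
  init : θ 0 = θ₀
  flow : ∀ t : ℝ, 0 ≤ t →
    HasDerivWithinAt θ (-gradient (loss σ fstar x) (θ t)) (Ici 0) t

/-- The supremum norm of a function on the real line. -/
def supNorm (g : ℝ → ℝ) : ℝ := ⨆ z, |g z|

/-- `D = 3 max{|σ(0)|, M ‖σ'‖_∞, ‖σ'‖_∞, 1}`. -/
def constD (σ : ℝ → ℝ) (M : ℝ) : ℝ :=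
  3 * max |σ 0| (max (M * supNorm (deriv σ)) (max (supNorm (deriv σ)) 1))

/-- The operator norm of `W` with respect to the Euclidean norms. -/
def matrixOpNorm (W : Matrix (Fin m) (Fin d) ℝ) : ℝ :=
  ‖LinearMap.toContinuousLinearMap (Matrix.toEuclideanLin (𝕜 := ℝ) W)‖

/-- `ξ = max{m^{-1/2}‖W‖_op, m^{-1/2}‖b‖₂, m^{-1/2}‖a‖₂, 1}`. -/
def xi (θ : Params m d) : ℝ :=
  max (matrixOpNorm (innerWeights θ) / Real.sqrt m)
    (max (‖innerBias θ‖ / Real.sqrt m) (max (‖outerWeights θ‖ / Real.sqrt m) 1))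

/-- `ξ̃ = max{max_ℓ ‖w_ℓ‖₂, ‖a‖_∞, ‖b‖_∞, 1}`. -/
def xiTilde (θ : Params m d) : ℝ :=
  max (⨆ ℓ, ‖weightRow θ ℓ‖)
    (max (⨆ ℓ, |outerWeights θ ℓ|) (max (⨆ ℓ, |innerBias θ ℓ|) 1))

/-! ### Continuity facts, which make the objects on `L²` below well defined -/

theorem contDiff_network {σ : ℝ → ℝ} (hσ : ContDiff ℝ 2 σ) :
    ContDiff ℝ 2 (fun q : Input d × Params m d => network σ q.2 q.1) := by
  have hcoord : ∀ i : ParamIndex m d,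
      ContDiff ℝ 2 (fun q : Input d × Params m d => q.2 i) := fun i =>
    (EuclideanSpace.proj (𝕜 := ℝ) i).contDiff.comp contDiff_snd
  have hx : ∀ j : Fin d, ContDiff ℝ 2 (fun q : Input d × Params m d => q.1 j) := fun j =>
    (EuclideanSpace.proj (𝕜 := ℝ) j).contDiff.comp contDiff_fst
  simp only [network, outerWeights, weightRow, innerWeights, innerBias, outerBias,
    PiLp.inner_apply, Matrix.of_apply]
  refine ContDiff.add (contDiff_const.mul (ContDiff.sum fun ℓ _ => ?_)) (hcoord _)
  refine (hcoord _).mul (hσ.comp (ContDiff.add (ContDiff.sum fun j _ => ?_) (hcoord _)))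
  simpa using (hx j).mul (hcoord _)

theorem continuous_network {σ : ℝ → ℝ} (hσ : ContDiff ℝ 2 σ) (θ : Params m d) :
    Continuous (network σ θ) :=
  (contDiff_network hσ).continuous.comp (continuous_id.prodMk continuous_const)

theorem continuous_gradient_network {σ : ℝ → ℝ} (hσ : ContDiff ℝ 2 σ) (θ : Params m d) :
    Continuous fun x : Input d => gradient (fun η : Params m d => network σ η x) θ := by
  have h : ContDiff ℝ 1 fun x : Input d =>
      fderiv ℝ ((fun (y : Input d) (η : Params m d) => network σ η y) x) θ :=
    ContDiff.fderiv (n := 1) (m := 2) (contDiff_network hσ) contDiff_const (by norm_num)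
  exact (InnerProductSpace.toDual ℝ (Params m d)).symm.continuous.comp h.continuous

theorem continuous_ntk {σ : ℝ → ℝ} (hσ : ContDiff ℝ 2 σ) (θ : Params m d) (X : Set (Input d)) :
    Continuous fun q : X × X => ntk σ θ (q.1 : Input d) (q.2 : Input d) := by
  have h := continuous_gradient_network hσ θ
  exact (h.comp (continuous_subtype_val.comp continuous_fst)).inner
    (h.comp (continuous_subtype_val.comp continuous_snd))

section L2

variable {X : Set (Input d)} [CompactSpace X] (ρ : Measure X) [IsProbabilityMeasure ρ]

theorem integrable_kernel_mul {K : X × X → ℝ} (hK : Continuous K) (h : Lp ℝ 2 ρ) (x : X) :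
    Integrable (fun s => K (x, s) * h s) ρ := by
  obtain ⟨B, hB⟩ := isCompact_univ.exists_bound_of_continuousOn hK.continuousOn
  exact ((Lp.memLp h).integrable (by norm_num)).bdd_mul
    (hK.comp (continuous_const.prodMk continuous_id)).aestronglyMeasurable
    (Filter.Eventually.of_forall fun s => hB (x, s) (mem_univ _))

theorem norm_integral_kernel_le {K : X × X → ℝ} {B : ℝ} (hB : ∀ q, ‖K q‖ ≤ B)
    (h : Lp ℝ 2 ρ) (x : X) : ‖∫ s, K (x, s) * h s ∂ρ‖ ≤ B * ‖h‖ := by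
  have hB0 : 0 ≤ B := (norm_nonneg _).trans (hB (x, x))
  have hint : Integrable (fun s => h s) ρ := (Lp.memLp h).integrable (by norm_num)
  have h1 : ∫ s, ‖h s‖ ∂ρ ≤ ‖h‖ := by
    rw [integral_norm_eq_lintegral_enorm hint.aestronglyMeasurable, Lp.norm_def,
      ← eLpNorm_one_eq_lintegral_enorm]
    exact ENNReal.toReal_mono (Lp.memLp h).eLpNorm_ne_top
      (eLpNorm_le_eLpNorm_of_exponent_le (by norm_num) hint.aestronglyMeasurable)
  calc ‖∫ s, K (x, s) * h s ∂ρ‖ ≤ ∫ s, B * ‖h s‖ ∂ρ := by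
        refine norm_integral_le_of_norm_le (hint.norm.const_mul B)
          (Filter.Eventually.of_forall fun s => ?_)
        rw [norm_mul]
        exact mul_le_mul_of_nonneg_right (hB _) (norm_nonneg _)
    _ = B * ∫ s, ‖h s‖ ∂ρ := integral_const_mul _ _
    _ ≤ B * ‖h‖ := mul_le_mul_of_nonneg_left h1 hB0

theorem memLp_integral_kernel {K : X × X → ℝ} (hK : Continuous K) (h : Lp ℝ 2 ρ) :
    MemLp (fun x => ∫ s, K (x, s) * h s ∂ρ) 2 ρ := by
  obtain ⟨B, hB⟩ := isCompact_univ.exists_bound_of_continuousOn hK.continuousOn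
  refine MemLp.of_bound ?_ (B * ‖h‖) (Filter.Eventually.of_forall fun x =>
    norm_integral_kernel_le ρ (fun q => hB q (mem_univ _)) h x)
  have hm : StronglyMeasurable fun q : X × X => K q * h q.2 :=
    hK.stronglyMeasurable.mul ((Lp.stronglyMeasurable h).comp_measurable measurable_snd)
  exact hm.integral_prod_right'.aestronglyMeasurable

/-- The integral operator `T_K h(x) = ∫_X K(x, s) h(s) dρ(s)` on `L²(X, ρ)` of a continuous
kernel `K`. -/
def integralOperator (K : X × X → ℝ) (hK : Continuous K) : Lp ℝ 2 ρ →L[ℝ] Lp ℝ 2 ρ :=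
  LinearMap.mkContinuousOfExistsBound
    { toFun := fun h => (memLp_integral_kernel ρ hK h).toLp _
      map_add' := fun g h => by
        rw [← MemLp.toLp_add]
        refine MemLp.toLp_congr _ _ (Filter.Eventually.of_forall fun x => ?_)
        simp only [Pi.add_apply]
        rw [← integral_add (integrable_kernel_mul ρ hK g x) (integrable_kernel_mul ρ hK h x)]
        refine integral_congr_ae ?_
        filter_upwards [Lp.coeFn_add g h] with s hs
        rw [hs, Pi.add_apply, mul_add]
      map_smul' := fun c h => by
        rw [RingHom.id_apply, ← MemLp.toLp_const_smul]
        refine MemLp.toLp_congr _ _ (Filter.Eventually.of_forall fun x => ?_)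
        simp only [Pi.smul_apply, smul_eq_mul]
        rw [← integral_const_mul]
        refine integral_congr_ae ?_
        filter_upwards [Lp.coeFn_smul c h] with s hs
        rw [hs, Pi.smul_apply, smul_eq_mul]
        ring }
    (by
      obtain ⟨B, hB⟩ := isCompact_univ.exists_bound_of_continuousOn hK.continuousOn
      obtain ⟨x⟩ : Nonempty X := nonempty_of_isProbabilityMeasure ρ
      have hB0 : 0 ≤ B := (norm_nonneg _).trans (hB (x, x) (mem_univ _))
      refine ⟨B, fun h => ?_⟩
      have := Lp.norm_le_of_ae_bound (f := (memLp_integral_kernel ρ hK h).toLp _)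
        (mul_nonneg hB0 (norm_nonneg h)) (by
          filter_upwards [(memLp_integral_kernel ρ hK h).coeFn_toLp] with y hy
          rw [hy]
          exact norm_integral_kernel_le ρ (fun q => hB q (mem_univ _)) h y)
      simpa [measureUnivNNReal] using this)

/-- The operator acts by the integral formula. -/
theorem integralOperator_coeFn (K : X × X → ℝ) (hK : Continuous K) (h : Lp ℝ 2 ρ) :
    integralOperator ρ K hK h =ᵐ[ρ] fun x => ∫ s, K (x, s) * h s ∂ρ :=
  (memLp_integral_kernel ρ hK h).coeFn_toLp

/-- The integral operator `T_{K_θ}` of the neural tangent kernel at `θ`.  As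
`K_θ(x, x')` is an inner product of feature vectors in `ℝ^p`, this operator has rank at most `p`, so
its nonzero eigenvalues, with multiplicity, form a finite list. -/
def ntkOperator {σ : ℝ → ℝ} (hσ : ContDiff ℝ 2 σ) (θ : Params m d) : Lp ℝ 2 ρ →L[ℝ] Lp ℝ 2 ρ :=
  integralOperator ρ (fun q : X × X => ntk σ θ (q.1 : Input d) (q.2 : Input d))
    (continuous_ntk hσ θ X)

theorem memLp_residual {σ : ℝ → ℝ} (hσ : ContDiff ℝ 2 σ) {fstar : X → ℝ}
    (hf : MemLp fstar ∞ ρ) (θ : Params m d) :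
    MemLp (fun x : X => network σ θ (x : Input d) - fstar x) 2 ρ := by
  have hc : Continuous fun x : X => network σ θ (x : Input d) :=
    (continuous_network hσ θ).comp continuous_subtype_val
  obtain ⟨B, hB⟩ := isCompact_univ.exists_bound_of_continuousOn hc.continuousOn
  exact (MemLp.of_bound hc.aestronglyMeasurable B
    (Filter.Eventually.of_forall fun x => hB x (mem_univ _))).sub (hf.mono_exponent le_top)

/-- The residual `f(·; θ) - f*` as an element of `L²(X, ρ)`. -/
def residual {σ : ℝ → ℝ} (hσ : ContDiff ℝ 2 σ) {fstar : X → ℝ} (hf : MemLp fstar ∞ ρ)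
    (θ : Params m d) : Lp ℝ 2 ρ :=
  (memLp_residual ρ hσ hf θ).toLp _

end L2

section Eigen

variable {H : Type*} [NormedAddCommGroup H] [InnerProductSpace ℝ H]

/-- `φ` is an orthonormal family of eigenvectors of `A` for its nonzero eigenvalues
`s 0 ≥ s 1 ≥ ⋯`, listed with multiplicity, which exhausts the eigenspaces of all nonzero
eigenvalues. -/
structure IsEigenEnumeration (A : H →L[ℝ] H) {N : ℕ} (s : Fin N → ℝ) (φ : Fin N → H) : Prop where
  antitone : Antitone s
  ne_zero : ∀ i, s i ≠ 0
  orthonormal : Orthonormal ℝ φ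
  eigen : ∀ i, A (φ i) = s i • φ i
  exhaust : ∀ μ : ℝ, μ ≠ 0 → ∀ h : H, A h = μ • h → h ∈ Submodule.span ℝ (range φ)

/-- The orthogonal projection onto the span of `φ 0, …, φ k` (indices start at `0`, so this is
the projection onto the top `k + 1` vectors). -/
def topProjection {N : ℕ} (φ : Fin N → H) (k : Fin N) : H →L[ℝ] H :=
  haveI : FiniteDimensional ℝ (Submodule.span ℝ (φ '' Iic k)) :=
    FiniteDimensional.span_of_finite ℝ ((finite_Iic k).image φ)
  (Submodule.span ℝ (φ '' Iic k)).starProjection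

end Eigen

end ShallowNTK

end

open ShallowNTK

/-! Write Ψ_θ : v ↦ ⟨∂_θ f(·; θ), v⟩ for the linearized network as an operator into L²(X, ρ)
(`featureOp`), and Ψ_0 for its value at θ₀. Then T_{K_0} = Ψ_0 Ψ_0† (`ntkOperator_eq`), and along
the flow ∂_t r_t = -Ψ_{θ_t} ∇Φ(θ_t) (`hasFDerivAt_residual`). So r' = g - T_{K_0} r with the forcing
g_u = T_{K_0} r_u - Ψ_{θ_u} ∇Φ(θ_u). If ‖g_u‖ ≤ E on [0, t), variation of constants gives both
bounds: e^{-τT_{K_0}} is a contraction by positivity, P_k e^{-τT_{K_0}} has norm at most e^{-σ_k τ},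
and integrating over τ ∈ [0, t] yields the factors t and (1 - e^{-σ_k t})/σ_k.

To bound g_u, insert the sample average v_u = n⁻¹ ∑ r_u(x_i) ∂_θ f(x_i; θ₀), which is ∇Φ(θ_u) with
the features frozen at θ₀: g_u = (Ψ_0 v_u - Ψ_{θ_u} ∇Φ(θ_u)) + Ψ_0 (Ψ_0† r_u - v_u).

The first bracket is the drift of the features. They are Lipschitz in θ with constant of order
ξ̃(0)/√m (`norm_featureVec_sub_le`), and Grönwall gives ‖θ_u - θ₀‖ of order ξ(0) ‖r̂_0‖ u
(`IsGradientFlow.norm_sub_le`); the lower bound on m keeps the Grönwall exponential bounded.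

The second bracket is sampling error, multiplied by ‖Ψ_0‖ ≤ √σ₁
(`IsEigenEnumeration.norm_apply_le`). As θ_u depends on the sample, the error is controlled
uniformly over a deterministic ball containing every trajectory up to time T. Pairing with unit
vectors turns it into a process indexed by the unit ball of a 2p-dimensional space, and Hoeffding's
inequality on a net of mesh 1/n applies (`measure_exists_deviation_le`). The resulting event does
not involve k, the time or the chosen flow. -/

namespace ShallowNTK

/-! ### The semigroup e^{-tA} and variation of constants -/

section Semigroup

variable {H : Type*} [NormedAddCommGroup H] [InnerProductSpace ℝ H] [CompleteSpace H]

theorem hasDerivAt_exp_neg_smul (A : H →L[ℝ] H) (t : ℝ) :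
    HasDerivAt (fun u : ℝ => NormedSpace.exp (-(u • A)))
      (-(NormedSpace.exp (-(t • A)) * A)) t := by
  have h := hasDerivAt_exp_smul_const (𝕂 := ℝ) (-A) t
  simpa [smul_neg] using h

theorem hasDerivAt_exp_neg_smul' (A : H →L[ℝ] H) (t : ℝ) :
    HasDerivAt (fun u : ℝ => NormedSpace.exp (-(u • A)))
      (-(A * NormedSpace.exp (-(t • A)))) t := by
  have h := hasDerivAt_exp_smul_const' (𝕂 := ℝ) (-A) t
  simpa [smul_neg] using h

/-- The curve u ↦ e^{cu} e^{-uA} v has zero derivative, hence is constant. -/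
theorem exp_neg_smul_apply_eigen {A : H →L[ℝ] H} {v : H} {c : ℝ} (hv : A v = c • v) (t : ℝ) :
    NormedSpace.exp (-(t • A)) v = Real.exp (-(c * t)) • v := by
  have hd : ∀ u : ℝ, HasDerivAt
      (fun u : ℝ => Real.exp (c * u) • NormedSpace.exp (-(u • A)) v) 0 u := by
    intro u
    have h1 := (hasDerivAt_exp_neg_smul A u).clm_apply (hasDerivAt_const u v)
    have h2 : HasDerivAt (fun u : ℝ => Real.exp (c * u)) (Real.exp (c * u) * c) u := by
      simpa using ((hasDerivAt_id u).const_mul c).exp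
    convert! h2.smul h1 using 1
    simp [hv, smul_smul]
  have h := is_const_of_deriv_eq_zero (fun u => (hd u).differentiableAt)
    (fun u => (hd u).deriv) t 0
  simp only [mul_zero, Real.exp_zero, zero_smul, neg_zero, NormedSpace.exp_zero, one_smul,
    one_apply_eq_self] at h
  conv_rhs => rw [← h]
  rw [smul_smul, ← Real.exp_add]
  simp

/-- Positivity of A makes u ↦ ‖e^{-uA} v‖² nonincreasing. -/
theorem norm_exp_neg_smul_apply_le {A : H →L[ℝ] H} (hA : ∀ v, 0 ≤ inner ℝ (A v) v) {t : ℝ}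
    (ht : 0 ≤ t) (v : H) : ‖NormedSpace.exp (-(t • A)) v‖ ≤ ‖v‖ := by
  have hd : ∀ u : ℝ, HasDerivAt (fun u : ℝ => ‖NormedSpace.exp (-(u • A)) v‖ ^ 2)
      (2 * inner ℝ (NormedSpace.exp (-(u • A)) v) (-(A (NormedSpace.exp (-(u • A)) v)))) u := by
    intro u
    have h1 := (hasDerivAt_exp_neg_smul' A u).clm_apply (hasDerivAt_const u v)
    simpa using h1.norm_sq
  have hanti : Antitone fun u : ℝ => ‖NormedSpace.exp (-(u • A)) v‖ ^ 2 := by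
    refine antitone_of_deriv_nonpos (fun u => (hd u).differentiableAt) fun u => ?_
    rw [(hd u).deriv, inner_neg_right, real_inner_comm]
    linarith [hA (NormedSpace.exp (-(u • A)) v)]
  have h := hanti ht
  simp only [zero_smul, neg_zero, NormedSpace.exp_zero, one_apply_eq_self] at h
  exact le_of_sq_le_sq h (norm_nonneg _)

theorem inner_exp_neg_smul_apply {A : H →L[ℝ] H} (hA : IsSelfAdjoint A) (t : ℝ) (v w : H) :
    inner ℝ (NormedSpace.exp (-(t • A)) v) w = inner ℝ v (NormedSpace.exp (-(t • A)) w) := by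
  have h1 : IsSelfAdjoint (-(t • A)) := (IsSelfAdjoint.smul (star_trivial t) hA).neg
  have h2 : IsSelfAdjoint (NormedSpace.exp (-(t • A))) := by
    rw [IsSelfAdjoint, NormedSpace.star_exp, h1.star_eq]
  exact h2.isSymmetric v w

theorem norm_exp_neg_smul_apply_le_of_mem_span {A : H →L[ℝ] H} {N : ℕ} {s : Fin N → ℝ}
    {φ : Fin N → H} (h : IsEigenEnumeration A s φ) (k : Fin N) {t : ℝ} (ht : 0 ≤ t) {v : H}
    (hv : v ∈ Submodule.span ℝ (φ '' Iic k)) :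
    ‖NormedSpace.exp (-(t • A)) v‖ ≤ Real.exp (-(s k * t)) * ‖v‖ := by
  rw [← Finset.coe_Iic, Submodule.mem_span_image_finset_iff_exists_fun'] at hv
  obtain ⟨c, rfl⟩ := hv
  have hsq : ∀ b : Fin N → ℝ, ‖∑ i ∈ Finset.Iic k, b i • φ i‖ ^ 2 = ∑ i ∈ Finset.Iic k, b i ^ 2 := by
    intro b
    rw [← real_inner_self_eq_norm_sq, h.orthonormal.inner_sum]
    simp [sq]
  have he : NormedSpace.exp (-(t • A)) (∑ i ∈ Finset.Iic k, c i • φ i) =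
      ∑ i ∈ Finset.Iic k, (Real.exp (-(s i * t)) * c i) • φ i := by
    rw [map_sum]
    refine Finset.sum_congr rfl fun i _ => ?_
    rw [map_smul, exp_neg_smul_apply_eigen (h.eigen i), smul_smul, mul_comm]
  refine le_of_sq_le_sq ?_ (by positivity)
  rw [he, mul_pow, hsq, hsq, Finset.mul_sum]
  refine Finset.sum_le_sum fun i hi => ?_
  rw [mul_pow]
  have hs : s k ≤ s i := h.antitone (Finset.mem_Iic.1 hi)
  gcongr

/-- With u = P_k e^{-tA} v, self-adjointness moves the semigroup onto u: ‖u‖² = ⟨e^{-tA} u, v⟩.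
Since u lies in the span of the top eigenvectors, neither a spectral decomposition of H nor
commutation of P_k with the semigroup is needed. -/
theorem norm_topProjection_exp_le {A : H →L[ℝ] H} (hA : IsSelfAdjoint A) {N : ℕ} {s : Fin N → ℝ}
    {φ : Fin N → H} (h : IsEigenEnumeration A s φ) (k : Fin N) {t : ℝ} (ht : 0 ≤ t) (v : H) :
    ‖topProjection φ k (NormedSpace.exp (-(t • A)) v)‖ ≤ Real.exp (-(s k * t)) * ‖v‖ := by
  have : FiniteDimensional ℝ (Submodule.span ℝ (φ '' Iic k)) :=
    FiniteDimensional.span_of_finite ℝ ((finite_Iic k).image φ)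
  set e := NormedSpace.exp (-(t • A)) with he
  set U := Submodule.span ℝ (φ '' Iic k)
  change ‖U.starProjection (e v)‖ ≤ _
  set u := U.starProjection (e v) with hu
  have huU : u ∈ U := U.starProjection_apply_mem _
  have h1 : ‖u‖ ^ 2 = inner ℝ (e u) v := by
    rw [inner_exp_neg_smul_apply hA, ← he, ← real_inner_self_eq_norm_sq]
    nth_rewrite 2 [hu]
    rw [← Submodule.inner_starProjection_left_eq_right, Submodule.starProjection_eq_self_iff.2 huU]
  have h2 : ‖u‖ ^ 2 ≤ Real.exp (-(s k * t)) * ‖u‖ * ‖v‖ := by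
    rw [h1]
    exact (real_inner_le_norm _ _).trans (mul_le_mul_of_nonneg_right
      (norm_exp_neg_smul_apply_le_of_mem_span h k ht huU) (norm_nonneg _))
  rcases (norm_nonneg u).eq_or_lt with h0 | h0
  · rw [← h0]; positivity
  · refine le_of_mul_le_mul_right ?_ h0
    linarith

/-- Variation of constants for `r' = g - A r`, in the form of a norm bound. -/
theorem norm_apply_sub_exp_apply_le {A P : H →L[ℝ] H} {r g : ℝ → H} {t : ℝ} (ht : 0 ≤ t)
    (hr : ContinuousOn r (Icc 0 t))
    (hr' : ∀ s ∈ Ico 0 t, HasDerivWithinAt r (g s - A (r s)) (Ici s) s)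
    {B B' : ℝ → ℝ} (hB0 : B 0 = 0) (hB : ∀ s, HasDerivAt B (B' s) s)
    (hg : ∀ s ∈ Ico 0 t, ‖P (NormedSpace.exp (-((t - s) • A)) (g s))‖ ≤ B' s) :
    ‖P (r t - NormedSpace.exp (-(t • A)) (r 0))‖ ≤ B t := by
  have he : ∀ s, HasDerivAt (fun s : ℝ => NormedSpace.exp (-((t - s) • A)))
      (NormedSpace.exp (-((t - s) • A)) * A) s := by
    intro s
    have := (hasDerivAt_exp_neg_smul A (t - s)).scomp s ((hasDerivAt_id s).const_sub t)
    simpa using! this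
  set e : ℝ → H →L[ℝ] H := fun s => NormedSpace.exp (-((t - s) • A)) with hedef
  have hc : ContinuousOn (fun s => P (e s (r s) - e 0 (r 0))) (Icc 0 t) := by
    have : ContinuousOn (fun s => e s (r s)) (Icc 0 t) :=
      (continuous_iff_continuousAt.2 fun s => (he s).continuousAt).continuousOn.clm_apply hr
    exact P.continuous.comp_continuousOn (this.sub continuousOn_const)
  -- The two terms containing A cancel in the product rule. Comparing norms with the boundary
  -- function B, instead of integrating, avoids any regularity assumption on g.
  have hd : ∀ s ∈ Ico 0 t, HasDerivWithinAt (fun s => P (e s (r s) - e 0 (r 0)))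
      (P (e s (g s))) (Ici s) s := by
    intro s hs
    have h1 := ((he s).hasDerivWithinAt (s := Ici s)).clm_apply (hr' s hs)
    have h2 := P.hasFDerivAt.comp_hasDerivWithinAt s (h1.sub_const (e 0 (r 0)))
    convert! h2 using 2
    simp [hedef]
  have hmain := image_norm_le_of_norm_deriv_right_le_deriv_boundary hc hd
    (by simp [hB0]) hB hg (right_mem_Icc.2 ht)
  simpa [hedef] using hmain

end Semigroup

/-! ### Nets of the unit ball in finite dimension -/

section Net

variable {E : Type*} [NormedAddCommGroup E] [NormedSpace ℝ E] [FiniteDimensional ℝ E]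

/-- Balls of radius 1/(2n) around the points are disjoint and lie in the ball of radius 1 + 1/(2n);
the ratio of these radii is 2n + 1. -/
theorem card_le_of_separated_unitBall {n : ℕ} (hn : 0 < n) (s : Finset E)
    (hs : ∀ c ∈ s, ‖c‖ ≤ 1)
    (h : ∀ c ∈ s, ∀ c' ∈ s, c ≠ c' → 1 / (n : ℝ) ≤ ‖c - c'‖) :
    s.card ≤ (2 * n + 1) ^ Module.finrank ℝ E := by
  borelize E
  have hn' : (0 : ℝ) < n := by exact_mod_cast hn
  let μ : Measure E := Measure.addHaar
  set r : ℝ := 1 / (2 * n) with hr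
  have hr0 : 0 < r := by positivity
  have hD : Set.Pairwise (s : Set E)
      (Function.onFun Disjoint fun c => Metric.ball (c : E) r) := by
    intro c hc c' hc' hcc
    apply Metric.ball_disjoint_ball
    rw [dist_eq_norm]
    refine le_trans (le_of_eq ?_) (h c hc c' hc' hcc)
    rw [hr]; field_simp; norm_num
  have hsub : (⋃ c ∈ s, Metric.ball (c : E) r) ⊆ Metric.ball (0 : E) (1 + r) := by
    refine iUnion₂_subset fun x hx => Metric.ball_subset_ball' ?_
    rw [dist_zero_right]
    linarith [hs x hx]
  have hI : (s.card : ℝ≥0∞) * ENNReal.ofReal (r ^ Module.finrank ℝ E) * μ (Metric.ball 0 1) ≤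
      ENNReal.ofReal ((1 + r) ^ Module.finrank ℝ E) * μ (Metric.ball 0 1) := by
    rw [← μ.addHaar_ball_of_pos (0 : E) (by positivity)]
    refine le_trans (le_of_eq ?_) (measure_mono hsub)
    rw [measure_biUnion_finset hD fun c _ => measurableSet_ball]
    simp only [μ.addHaar_ball_of_pos _ hr0, Finset.sum_const, nsmul_eq_mul, mul_assoc]
  have hJ := (ENNReal.mul_le_mul_iff_left
    (Metric.measure_ball_pos _ _ zero_lt_one).ne' measure_ball_lt_top.ne).1 hI
  have hK := ENNReal.toReal_le_of_le_ofReal (by positivity) hJ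
  rw [ENNReal.toReal_mul, ENNReal.toReal_natCast, ENNReal.toReal_ofReal (by positivity),
    ← le_div_iff₀ (by positivity), ← div_pow] at hK
  have hq : (1 + r) / r = ((2 * n + 1 : ℕ) : ℝ) := by
    rw [hr]; push_cast; field_simp
  rw [hq] at hK
  exact_mod_cast hK

/-- A separated set of maximal cardinality is a net, since an uncovered point could be added to it;
the volume bound ensures that a maximum exists. -/
theorem exists_net_unitBall {n : ℕ} (hn : 0 < n) :
    ∃ s : Finset E, s.card ≤ (2 * n + 1) ^ Module.finrank ℝ E ∧ (∀ c ∈ s, ‖c‖ ≤ 1) ∧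
      ∀ e : E, ‖e‖ ≤ 1 → ∃ c ∈ s, ‖e - c‖ ≤ 1 / (n : ℝ) := by
  classical
  let Q : Set ℕ := {k | ∃ s : Finset E, s.card = k ∧ (∀ c ∈ s, ‖c‖ ≤ 1) ∧
    ∀ c ∈ s, ∀ c' ∈ s, c ≠ c' → 1 / (n : ℝ) ≤ ‖c - c'‖}
  have hQ : BddAbove Q := by
    refine ⟨(2 * n + 1) ^ Module.finrank ℝ E, ?_⟩
    rintro k ⟨s, rfl, h1, h2⟩
    exact card_le_of_separated_unitBall hn s h1 h2
  have hne : Q.Nonempty := ⟨0, ∅, by simp⟩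
  obtain ⟨s, hcard, h1, h2⟩ := Nat.sSup_mem hne hQ
  refine ⟨s, card_le_of_separated_unitBall hn s h1 h2, h1, fun e he => ?_⟩
  by_contra! hcon
  have hes : e ∉ s := fun h => by
    have := hcon e h
    rw [sub_self, norm_zero] at this
    exact absurd this (not_lt.2 (by positivity))
  have hmem : (insert e s).card ∈ Q := by
    refine ⟨insert e s, rfl, ?_, ?_⟩
    · intro c hc
      rcases Finset.mem_insert.1 hc with rfl | hc
      exacts [he, h1 c hc]
    · intro c hc c' hc' hne
      rcases Finset.mem_insert.1 hc with hc | hc <;>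
        rcases Finset.mem_insert.1 hc' with hc' | hc'
      · exact absurd (hc.trans hc'.symm) hne
      · rw [hc]; exact (hcon c' hc').le
      · rw [hc', norm_sub_rev]; exact (hcon c hc).le
      · exact h2 c hc c' hc' hne
  have := le_csSup hQ hmem
  rw [Finset.card_insert_of_notMem hes, ← hcard] at this
  omega

end Net

/-! ### Hoeffding's inequality and uniform deviation -/

section Deviation

variable {Ω : Type*} [MeasurableSpace Ω] (μ : Measure Ω) [IsProbabilityMeasure μ]

/-- Hoeffding: values in an interval of length 2b have sub-Gaussian variance proxy b². -/
theorem measure_avg_sub_integral_ge_le {n : ℕ} (hn : 0 < n) {h : Ω → ℝ} {b : ℝ} (hb : 0 < b)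
    (hm : AEMeasurable h μ) (hbd : ∀ᵐ x ∂μ, |h x| ≤ b) {τ : ℝ} (hτ : 0 ≤ τ) :
    Measure.pi (fun _ : Fin n => μ)
      {x | τ ≤ (1 / (n : ℝ)) * ∑ i, h (x i) - ∫ y, h y ∂μ} ≤
      ENNReal.ofReal (Real.exp (-(n * τ ^ 2 / (2 * b ^ 2)))) := by
  have hn' : (0 : ℝ) < n := by exact_mod_cast hn
  set ν := Measure.pi (fun _ : Fin n => μ) with hν
  have hind : ProbabilityTheory.iIndepFun
      (fun (i : Fin n) (x : Fin n → Ω) => h (x i) - ∫ y, h y ∂μ) ν :=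
    ProbabilityTheory.iIndepFun_pi (X := fun _ y => h y - ∫ z, h z ∂μ)
      fun _ => hm.sub_const _
  have hsub : ∀ i : Fin n, ProbabilityTheory.HasSubgaussianMGF
      (fun x : Fin n → Ω => h (x i) - ∫ y, h y ∂μ) ((‖b - -b‖₊ / 2) ^ 2) ν := by
    intro i
    have h1 : ProbabilityTheory.HasSubgaussianMGF
      (fun y => h y - ∫ z, h z ∂μ) ((‖b - -b‖₊ / 2) ^ 2) μ :=
      ProbabilityTheory.hasSubgaussianMGF_of_mem_Icc hm
        (hbd.mono fun x hx => abs_le.1 hx)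
    have hmp : ν.map (Function.eval i) = μ := (measurePreserving_eval (fun _ => μ) i).map_eq
    refine ProbabilityTheory.HasSubgaussianMGF.of_map
      (X := fun y => h y - ∫ z, h z ∂μ) (measurable_pi_apply i).aemeasurable ?_
    rw [hmp]; exact h1
  have hH := ProbabilityTheory.HasSubgaussianMGF.measure_sum_ge_le_of_iIndepFun hind
    (s := Finset.univ) (fun i _ => hsub i) (ε := n * τ) (by positivity)
  have hset : {x : Fin n → Ω | n * τ ≤ ∑ i, (h (x i) - ∫ y, h y ∂μ)} =
      {x | τ ≤ (1 / (n : ℝ)) * ∑ i, h (x i) - ∫ y, h y ∂μ} := by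
    ext x
    simp only [mem_ofPred_eq, Finset.sum_sub_distrib, Finset.sum_const, Finset.card_univ,
      Fintype.card_fin, nsmul_eq_mul]
    rw [← mul_le_mul_iff_right₀ hn' (b := τ)]
    have : (n : ℝ) * (1 / n * ∑ i, h (x i) - ∫ y, h y ∂μ) =
      ∑ i, h (x i) - n * ∫ y, h y ∂μ := by field_simp
    rw [this]
  rw [hset] at hH
  rw [← ENNReal.ofReal_toReal (measure_ne_top ν _)]
  refine ENNReal.ofReal_le_ofReal (hH.trans (le_of_eq ?_))
  congr 1
  have : ‖b - -b‖ = 2 * b := by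
    rw [Real.norm_eq_abs, abs_of_pos (by linarith)]; ring
  simp only [Finset.sum_const, Finset.card_univ, Fintype.card_fin, nsmul_eq_mul]
  push_cast
  rw [this]
  field_simp

theorem measure_abs_avg_sub_integral_ge_le {n : ℕ} (hn : 0 < n) {h : Ω → ℝ} {b : ℝ} (hb : 0 < b)
    (hm : AEMeasurable h μ) (hbd : ∀ᵐ x ∂μ, |h x| ≤ b) {τ : ℝ} (hτ : 0 ≤ τ) :
    Measure.pi (fun _ : Fin n => μ)
      {x | τ ≤ |(1 / (n : ℝ)) * ∑ i, h (x i) - ∫ y, h y ∂μ|} ≤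
      ENNReal.ofReal (2 * Real.exp (-(n * τ ^ 2 / (2 * b ^ 2)))) := by
  have h1 := measure_avg_sub_integral_ge_le μ hn hb hm hbd hτ
  have h2 := measure_avg_sub_integral_ge_le μ hn hb hm.neg
    (by simpa using hbd) hτ
  rw [two_mul, ENNReal.ofReal_add (Real.exp_pos _).le (Real.exp_pos _).le]
  refine le_trans (measure_mono ?_) ((measure_union_le _ _).trans (add_le_add h1 h2))
  intro x hx
  rcases le_abs.1 (show τ ≤ _ from hx) with h | h
  · exact Or.inl h
  · refine Or.inr ?_
    simp only [mem_ofPred_eq, Pi.neg_apply, Finset.sum_neg_distrib, integral_neg]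
    linarith

variable {E : Type*} [NormedAddCommGroup E] [NormedSpace ℝ E] [FiniteDimensional ℝ E]

/-- Uniform deviation of empirical means over the unit ball of a finite-dimensional parameter
space. -/
theorem measure_exists_deviation_le {n : ℕ} (hn : 0 < n) (h : E → Ω → ℝ) {b : ℝ} (hb : 0 ≤ b)
    (hm : ∀ e, ‖e‖ ≤ 1 → AEMeasurable (h e) μ)
    (hbd : ∀ᵐ x ∂μ, ∀ e, ‖e‖ ≤ 1 → |h e x| ≤ b)
    (hlip : ∀ᵐ x ∂μ, ∀ e, ‖e‖ ≤ 1 → ∀ e', ‖e'‖ ≤ 1 → |h e x - h e' x| ≤ b * ‖e - e'‖)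
    (hq : 0 < Module.finrank ℝ E) {δ : ℝ} (hδ : 0 < δ) (hδ1 : δ < 1) :
    Measure.pi (fun _ : Fin n => μ)
      {x | ¬ ∀ e, ‖e‖ ≤ 1 → |(1 / (n : ℝ)) * ∑ i, h e (x i) - ∫ y, h e y ∂μ| ≤
        6 * b * Real.sqrt (Module.finrank ℝ E) * Real.log (Real.exp 1 * n / δ) / Real.sqrt n} ≤
      ENNReal.ofReal δ := by
  have hn' : (0 : ℝ) < n := by exact_mod_cast hn
  have hn1 : (1 : ℝ) ≤ n := by exact_mod_cast hn
  set q := Module.finrank ℝ E with hqdef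
  have hq1 : (1 : ℝ) ≤ q := by exact_mod_cast hq
  set ℓ := Real.log (Real.exp 1 * n / δ) with hℓ
  have hexpℓ : Real.exp ℓ = Real.exp 1 * n / δ := Real.exp_log (by positivity)
  have hℓ1 : 1 ≤ ℓ := by
    rw [hℓ, Real.le_log_iff_exp_le (by positivity), le_div_iff₀ hδ]
    nlinarith [Real.exp_pos 1]
  have hbd' : ∀ e, ‖e‖ ≤ 1 → ∀ᵐ x ∂μ, |h e x| ≤ b := fun e he => hbd.mono fun x hx => hx e he
  -- Hoeffding's exponent degenerates for b = 0, but then every h e with ‖e‖ ≤ 1 vanishes almost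
  -- everywhere.
  rcases hb.eq_or_lt with rfl | hb
  · have hae : ∀ᵐ x ∂Measure.pi (fun _ : Fin n => μ), ∀ i, ∀ e, ‖e‖ ≤ 1 → |h e (x i)| ≤ 0 := by
      rw [ae_all_iff]
      intro i
      exact (measurePreserving_eval (fun _ : Fin n => μ) i).quasiMeasurePreserving.ae hbd
    refine le_trans (le_of_eq ?_) zero_le
    refine measure_mono_null ?_ hae
    intro x hx hall
    apply hx
    intro e he
    have h1 : ∀ i, h e (x i) = 0 := fun i => abs_nonpos_iff.1 (hall i e he)
    have h2 : ∫ y, h e y ∂μ = 0 :=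
      integral_eq_zero_of_ae ((hbd' e he).mono fun y hy => abs_nonpos_iff.1 hy)
    simp [h1, h2]
  obtain ⟨s, hcard, hs1, hs2⟩ := exists_net_unitBall (E := E) hn
  -- The factor 4 gives the tail exponent 8qℓ², which beats the logarithm 2qℓ of the net size. The
  -- remaining 2 of the factor 6 pays for the two discretization errors b/n, one in the average and
  -- one in the integral.
  set τ : ℝ := 4 * b * Real.sqrt q * ℓ / Real.sqrt n with hτ
  have hsqn : 0 < Real.sqrt n := Real.sqrt_pos.2 hn'
  have hsqq : 1 ≤ Real.sqrt q := Real.one_le_sqrt.2 hq1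
  have hτ0 : 0 ≤ τ := by positivity
  have hint : ∀ e, ‖e‖ ≤ 1 → Integrable (h e) μ := fun e he =>
    Integrable.of_bound (hm e he).aestronglyMeasurable b (hbd' e he)
  have hlipn : ∀ᵐ x ∂Measure.pi (fun _ : Fin n => μ), ∀ i, ∀ e, ‖e‖ ≤ 1 → ∀ e', ‖e'‖ ≤ 1 →
      |h e (x i) - h e' (x i)| ≤ b * ‖e - e'‖ := by
    rw [ae_all_iff]
    intro i
    exact (measurePreserving_eval (fun _ : Fin n => μ) i).quasiMeasurePreserving.ae hlip
  -- The bad event is a union over uncountably many e. A single null set serves all of them in the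
  -- Lipschitz bound, so up to a null set finitely many net points cover the event.
  have hsubset : {x : Fin n → Ω | ¬ ∀ e, ‖e‖ ≤ 1 →
      |(1 / (n : ℝ)) * ∑ i, h e (x i) - ∫ y, h e y ∂μ| ≤
        6 * b * Real.sqrt q * ℓ / Real.sqrt n} ≤ᵐ[Measure.pi (fun _ : Fin n => μ)]
      ⋃ c ∈ s, {x | τ ≤ |(1 / (n : ℝ)) * ∑ i, h c (x i) - ∫ y, h c y ∂μ|} := by
    filter_upwards [hlipn] with x hlipx hx
    by_contra hnot
    have hcon : ∀ c ∈ s, |(1 / (n : ℝ)) * ∑ i, h c (x i) - ∫ y, h c y ∂μ| < τ := by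
      intro c hc
      by_contra hlt
      exact hnot (mem_biUnion hc (not_lt.1 hlt))
    refine hx fun e he => ?_
    obtain ⟨c, hc, hec⟩ := hs2 e he
    have hc1 := hs1 c hc
    have h1 : |(1 / (n : ℝ)) * ∑ i, h e (x i) - (1 / (n : ℝ)) * ∑ i, h c (x i)| ≤ b * (1 / n) := by
      rw [← mul_sub, ← Finset.sum_sub_distrib, abs_mul, abs_of_pos (by positivity : 0 < 1 / (n:ℝ))]
      have : |∑ i, (h e (x i) - h c (x i))| ≤ n * (b * (1 / n)) := by
        refine (Finset.abs_sum_le_sum_abs _ _).trans ?_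
        refine (Finset.sum_le_sum fun i _ => (hlipx i e he c hc1).trans
          (mul_le_mul_of_nonneg_left hec hb.le)).trans ?_
        simp
      calc _ ≤ 1 / (n : ℝ) * (n * (b * (1 / n))) := by gcongr
        _ = b * (1 / n) := by field_simp
    have h2 : |∫ y, h e y ∂μ - ∫ y, h c y ∂μ| ≤ b * (1 / n) := by
      rw [← integral_sub (hint e he) (hint c hc1)]
      have := norm_integral_le_of_norm_le_const (μ := μ) (f := fun y => h e y - h c y)
        (C := b * (1 / n)) (hlip.mono fun y hy => (hy e he c hc1).trans
          (mul_le_mul_of_nonneg_left hec hb.le))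
      simpa using this
    have h3 := (hcon c hc).le
    have h4 : b * (1 / n) ≤ b * Real.sqrt q * ℓ / Real.sqrt n := by
      have h5 : 1 / (n : ℝ) ≤ 1 / Real.sqrt n :=
        one_div_le_one_div_of_le hsqn (Real.sqrt_le_iff.2 ⟨hn'.le, by nlinarith⟩)
      calc b * (1 / n) ≤ b * (1 / Real.sqrt n) := by gcongr
        _ = b * 1 * 1 / Real.sqrt n := by ring
        _ ≤ _ := by gcongr
    have h6 : 6 * b * Real.sqrt q * ℓ / Real.sqrt n = τ + 2 * (b * Real.sqrt q * ℓ / Real.sqrt n) := by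
      rw [hτ]; ring
    rw [h6]
    rw [abs_le] at *
    constructor <;> linarith
  refine (measure_mono_ae hsubset).trans ((measure_biUnion_finset_le s _).trans ?_)
  refine (Finset.sum_le_sum fun c hc => measure_abs_avg_sub_integral_ge_le μ hn hb
    (hm c (hs1 c hc)) (hbd' c (hs1 c hc)) hτ0).trans ?_
  rw [Finset.sum_const, nsmul_eq_mul, ← ENNReal.ofReal_natCast, ← ENNReal.ofReal_mul (by positivity)]
  refine ENNReal.ofReal_le_ofReal ?_
  have hexp : (n : ℝ) * τ ^ 2 / (2 * b ^ 2) = 8 * q * ℓ ^ 2 := by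
    rw [hτ, div_pow, mul_pow, mul_pow, mul_pow, Real.sq_sqrt hn'.le, Real.sq_sqrt (by positivity)]
    field_simp
    norm_num
  rw [hexp]
  have h3n : ((2 * n + 1 : ℕ) : ℝ) ≤ Real.exp (2 * ℓ) := by
    have h1 : (n : ℝ) * 2 ≤ Real.exp ℓ := by
      rw [hexpℓ, le_div_iff₀ hδ]
      have := Real.add_one_le_exp (1 : ℝ)
      nlinarith
    have h2 : Real.exp (2 * ℓ) = Real.exp ℓ * Real.exp ℓ := by rw [← Real.exp_add, two_mul]
    rw [h2]
    push_cast
    nlinarith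
  have hc : (s.card : ℝ) ≤ Real.exp (2 * q * ℓ) := by
    calc (s.card : ℝ) ≤ ((2 * n + 1 : ℕ) : ℝ) ^ q := by exact_mod_cast hcard
      _ ≤ Real.exp (2 * ℓ) ^ q := by gcongr
      _ = Real.exp (2 * q * ℓ) := by rw [← Real.exp_nat_mul]; ring_nf
  have h2 : (2 : ℝ) ≤ Real.exp ℓ := by
    have := Real.add_one_le_exp ℓ
    linarith
  have hδ' : Real.exp (-ℓ) ≤ δ := by
    rw [Real.exp_neg, hexpℓ, inv_div, div_le_iff₀ (by positivity)]
    have := Real.add_one_le_exp (1 : ℝ)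
    have : 1 ≤ Real.exp 1 * n := by nlinarith
    nlinarith
  calc (s.card : ℝ) * (2 * Real.exp (-(8 * q * ℓ ^ 2)))
      ≤ Real.exp (2 * q * ℓ) * (Real.exp ℓ * Real.exp (-(8 * q * ℓ ^ 2))) := by gcongr
    _ = Real.exp (2 * q * ℓ + (ℓ + -(8 * q * ℓ ^ 2))) := by rw [Real.exp_add, Real.exp_add]
    _ ≤ Real.exp (-ℓ) := by
      apply Real.exp_le_exp.2
      have h7 : ℓ ≤ q * ℓ := by nlinarith
      have h8 : (q : ℝ) * ℓ ≤ q * ℓ ^ 2 := by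
        have : ℓ ≤ ℓ ^ 2 := by nlinarith
        gcongr
      nlinarith
    _ ≤ δ := hδ'

end Deviation

/-! ### Supremum norms and the constant D -/

section Scalar

theorem abs_le_supNorm {g : ℝ → ℝ} (hg : ∃ B : ℝ, ∀ z, |g z| ≤ B) (z : ℝ) : |g z| ≤ supNorm g := by
  obtain ⟨B, hB⟩ := hg
  exact le_ciSup (f := fun z => |g z|) ⟨B, by rintro _ ⟨z, rfl⟩; exact hB z⟩ z

theorem supNorm_nonneg (g : ℝ → ℝ) : 0 ≤ supNorm g :=
  Real.iSup_nonneg fun _ => abs_nonneg _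

theorem abs_sub_le_supNorm_deriv_mul {g : ℝ → ℝ} (hg : Differentiable ℝ g)
    (hb : ∃ B : ℝ, ∀ z, |deriv g z| ≤ B) (y z : ℝ) :
    |g y - g z| ≤ supNorm (deriv g) * |y - z| :=
  Convex.norm_image_sub_le_of_norm_deriv_le (s := univ) (fun x _ => hg x)
    (fun x _ => abs_le_supNorm hb x) convex_univ (mem_univ _) (mem_univ _)

theorem constD_bounds (σ : ℝ → ℝ) (M : ℝ) :
    3 ≤ constD σ M ∧ |σ 0| ≤ constD σ M / 3 ∧ M * supNorm (deriv σ) ≤ constD σ M / 3 ∧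
      supNorm (deriv σ) ≤ constD σ M / 3 := by
  have h : constD σ M / 3 = max |σ 0| (max (M * supNorm (deriv σ)) (max (supNorm (deriv σ)) 1)) := by
    rw [constD]; ring
  refine ⟨?_, ?_, ?_, ?_⟩
  · have : 1 ≤ constD σ M / 3 := by rw [h]; simp
    linarith
  all_goals rw [h]; simp

end Scalar

/-! ### The parameter gradient in coordinates -/

variable {m d : ℕ}

/-- The argument `⟨w_ℓ, x⟩ + b_ℓ` of the activation of the neuron `ℓ`. -/
noncomputable def preActivation (θ : Params m d) (x : Input d) (ℓ : Fin m) : ℝ :=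
  inner ℝ (weightRow θ ℓ) x + innerBias θ ℓ

/-- The parameter gradient `∂_θ f(x; θ)` of the network. -/
noncomputable def featureVec (σ : ℝ → ℝ) (θ : Params m d) (x : Input d) : Params m d :=
  WithLp.toLp 2 (Sum.elim (fun ℓ => σ (preActivation θ x ℓ) / Real.sqrt m)
    (Sum.elim (fun q => outerWeights θ q.1 * deriv σ (preActivation θ x q.1) / Real.sqrt m * x q.2)
      (Sum.elim (fun ℓ => outerWeights θ ℓ * deriv σ (preActivation θ x ℓ) / Real.sqrt m)
        (fun _ => 1))))

theorem inner_weightRow (θ : Params m d) (x : Input d) (ℓ : Fin m) :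
    inner ℝ (weightRow θ ℓ) x = ∑ j, θ (Sum.inr (Sum.inl (ℓ, j))) * x j := by
  simp [PiLp.inner_apply, weightRow, innerWeights, mul_comm]

theorem preActivation_eq (θ : Params m d) (x : Input d) (ℓ : Fin m) :
    preActivation θ x ℓ =
      ∑ j, θ (Sum.inr (Sum.inl (ℓ, j))) * x j + θ (Sum.inr (Sum.inr (Sum.inl ℓ))) := by
  rw [preActivation, inner_weightRow]
  rfl

theorem inner_featureVec (σ : ℝ → ℝ) (θ : Params m d) (x : Input d) (v : Params m d) :
    inner ℝ (featureVec σ θ x) v = ∑ ℓ, (σ (preActivation θ x ℓ) / Real.sqrt m * outerWeights v ℓ +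
      outerWeights θ ℓ * deriv σ (preActivation θ x ℓ) / Real.sqrt m * preActivation v x ℓ) +
        outerBias v := by
  simp only [preActivation_eq v]
  simp only [PiLp.inner_apply, featureVec, Fintype.sum_sum_type,
    Fintype.sum_prod_type, outerWeights, outerBias, Sum.elim_inl, Sum.elim_inr,
    mul_add, Finset.sum_add_distrib, Finset.mul_sum, RCLike.inner_apply, conj_trivial,
    Finset.univ_unique, Finset.sum_singleton, mul_one, ← add_assoc]
  refine congrArg₂ _ (congrArg₂ _ (congrArg₂ _ ?_ ?_) ?_) rfl
  · exact Finset.sum_congr rfl fun _ _ => mul_comm _ _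
  · exact Finset.sum_congr rfl fun _ _ => Finset.sum_congr rfl fun _ _ => by ring
  · exact Finset.sum_congr rfl fun _ _ => mul_comm _ _

theorem preActivation_sub (θ θ' : Params m d) (x : Input d) (ℓ : Fin m) :
    preActivation (θ - θ') x ℓ = preActivation θ x ℓ - preActivation θ' x ℓ := by
  simp only [preActivation, inner_weightRow, innerBias, PiLp.sub_apply, sub_mul,
    Finset.sum_sub_distrib]
  ring

theorem norm_sq_params (v : Params m d) : ‖v‖ ^ 2 = ∑ ℓ, outerWeights v ℓ ^ 2 +
    ∑ ℓ, ‖weightRow v ℓ‖ ^ 2 + ∑ ℓ, innerBias v ℓ ^ 2 + outerBias v ^ 2 := by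
  simp only [EuclideanSpace.real_norm_sq_eq, Fintype.sum_sum_type, Fintype.sum_prod_type,
    outerWeights, weightRow, innerWeights, innerBias, outerBias, Finset.univ_unique,
    Finset.sum_singleton, Matrix.of_apply]
  simp only [← add_assoc]

theorem hasFDerivAt_preActivation (θ : Params m d) (x : Input d) (ℓ : Fin m) :
    HasFDerivAt (fun η : Params m d => preActivation η x ℓ)
      ((∑ j, x j • EuclideanSpace.proj (𝕜 := ℝ) (Sum.inr (Sum.inl (ℓ, j)))) +
        EuclideanSpace.proj (𝕜 := ℝ) (Sum.inr (Sum.inr (Sum.inl ℓ))) :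
          Params m d →L[ℝ] ℝ) θ := by
  have h : (fun η : Params m d => preActivation η x ℓ) =
      ((∑ j, x j • EuclideanSpace.proj (𝕜 := ℝ) (Sum.inr (Sum.inl (ℓ, j)))) +
        EuclideanSpace.proj (𝕜 := ℝ) (Sum.inr (Sum.inr (Sum.inl ℓ))) :
          Params m d →L[ℝ] ℝ) := by
    funext η
    simp [preActivation, inner_weightRow, innerBias, mul_comm]
  rw [h]
  exact ContinuousLinearMap.hasFDerivAt _

theorem hasGradientAt_network {σ : ℝ → ℝ} (hσ : Differentiable ℝ σ) (θ : Params m d) (x : Input d) :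
    HasGradientAt (fun η : Params m d => network σ η x) (featureVec σ θ x) θ := by
  have hz := fun ℓ => (hσ (preActivation θ x ℓ)).hasDerivAt.comp_hasFDerivAt θ
    (hasFDerivAt_preActivation θ x ℓ)
  have ha : ∀ i, HasFDerivAt (fun η : Params m d => η i)
      (EuclideanSpace.proj (𝕜 := ℝ) i : Params m d →L[ℝ] ℝ) θ := fun i =>
    ContinuousLinearMap.hasFDerivAt (EuclideanSpace.proj (𝕜 := ℝ) i : Params m d →L[ℝ] ℝ)
  have hsum := HasFDerivAt.fun_sum (u := Finset.univ) fun ℓ (_ : ℓ ∈ Finset.univ) =>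
    (ha (Sum.inl ℓ)).mul (hz ℓ)
  have h := (hsum.const_mul (1 / Real.sqrt m)).add (ha (Sum.inr (Sum.inr (Sum.inr ()))))
  refine HasFDerivAt.congr_fderiv (f' := _) h ?_
  ext v
  rw [InnerProductSpace.toDual_apply_apply, inner_featureVec]
  simp only [preActivation_eq v, outerWeights, outerBias, add_apply, smul_apply, sum_apply,
    PiLp.proj_apply, smul_eq_mul, Finset.mul_sum, Function.comp]
  congr 1
  refine Finset.sum_congr rfl fun ℓ _ => ?_
  have : ∑ j, x j * v (Sum.inr (Sum.inl (ℓ, j))) = ∑ j, v (Sum.inr (Sum.inl (ℓ, j))) * x j :=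
    Finset.sum_congr rfl fun _ _ => mul_comm _ _
  rw [this]
  ring

theorem gradient_network {σ : ℝ → ℝ} (hσ : Differentiable ℝ σ) (θ : Params m d) (x : Input d) :
    gradient (fun η : Params m d => network σ η x) θ = featureVec σ θ x :=
  (hasGradientAt_network hσ θ x).gradient

theorem ntk_eq_inner {σ : ℝ → ℝ} (hσ : Differentiable ℝ σ) (θ : Params m d) (x x' : Input d) :
    ntk σ θ x x' = inner ℝ (featureVec σ θ x) (featureVec σ θ x') := by
  rw [ntk, gradient_network hσ, gradient_network hσ]

theorem continuous_featureVec {σ : ℝ → ℝ} (hσ : ContDiff ℝ 2 σ) (θ : Params m d) :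
    Continuous (featureVec σ θ : Input d → Params m d) := by
  have h := continuous_gradient_network hσ θ
  simpa only [gradient_network (hσ.differentiable (by norm_num))] using h

/-! ### Bounds for `ξ` -/

theorem one_le_xi (θ : Params m d) : 1 ≤ xi θ := by simp [xi]

theorem one_le_xiTilde (θ : Params m d) : 1 ≤ xiTilde θ := by simp [xiTilde]

theorem abs_outerWeights_le_xiTilde (θ : Params m d) (ℓ : Fin m) :
    |outerWeights θ ℓ| ≤ xiTilde θ := by
  refine le_trans (le_ciSup (f := fun ℓ => |outerWeights θ ℓ|) (Set.finite_range _).bddAbove ℓ) ?_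
  simp [xiTilde]

theorem toEuclideanLin_innerWeights_apply (θ : Params m d) (x : Input d) (ℓ : Fin m) :
    Matrix.toEuclideanLin (𝕜 := ℝ) (innerWeights θ) x ℓ = inner ℝ (weightRow θ ℓ) x := by
  rw [inner_weightRow]
  simp [Matrix.toLpLin_apply, Matrix.mulVec, dotProduct, innerWeights]

theorem sum_inner_weightRow_sq_le (θ : Params m d) (x : Input d) :
    ∑ ℓ, (inner ℝ (weightRow θ ℓ) x) ^ 2 ≤ (matrixOpNorm (innerWeights θ) * ‖x‖) ^ 2 := by
  have h := (LinearMap.toContinuousLinearMap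
    (Matrix.toEuclideanLin (𝕜 := ℝ) (innerWeights θ))).le_opNorm x
  have h2 := pow_le_pow_left₀ (norm_nonneg _) h 2
  rw [EuclideanSpace.real_norm_sq_eq] at h2
  simp only [LinearMap.coe_toContinuousLinearMap', toEuclideanLin_innerWeights_apply] at h2
  exact h2

theorem matrixOpNorm_innerWeights_le (θ : Params m d) : matrixOpNorm (innerWeights θ) ≤ ‖θ‖ := by
  refine ContinuousLinearMap.opNorm_le_bound _ (norm_nonneg _) fun x => ?_
  refine le_of_sq_le_sq ?_ (by positivity)
  rw [EuclideanSpace.real_norm_sq_eq]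
  simp only [LinearMap.coe_toContinuousLinearMap', toEuclideanLin_innerWeights_apply]
  calc ∑ ℓ, (inner ℝ (weightRow θ ℓ) x) ^ 2 ≤ ∑ ℓ, ‖weightRow θ ℓ‖ ^ 2 * ‖x‖ ^ 2 := by
        refine Finset.sum_le_sum fun ℓ _ => ?_
        rw [← mul_pow]
        exact sq_le_sq.2 ((abs_real_inner_le_norm _ _).trans (le_abs_self _))
    _ = (∑ ℓ, ‖weightRow θ ℓ‖ ^ 2) * ‖x‖ ^ 2 := by rw [Finset.sum_mul]
    _ ≤ (‖θ‖ * ‖x‖) ^ 2 := by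
        rw [mul_pow, norm_sq_params]
        gcongr
        have h1 : 0 ≤ ∑ ℓ, outerWeights θ ℓ ^ 2 := by positivity
        have h2 : 0 ≤ ∑ ℓ, innerBias θ ℓ ^ 2 := by positivity
        nlinarith [sq_nonneg (outerBias θ)]

theorem norm_outerWeights_le (θ : Params m d) : ‖outerWeights θ‖ ≤ ‖θ‖ := by
  refine le_of_sq_le_sq ?_ (norm_nonneg _)
  rw [norm_sq_params, EuclideanSpace.real_norm_sq_eq]
  have h1 : 0 ≤ ∑ ℓ, ‖weightRow θ ℓ‖ ^ 2 := by positivity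
  have h2 : 0 ≤ ∑ ℓ, innerBias θ ℓ ^ 2 := by positivity
  nlinarith [sq_nonneg (outerBias θ)]

theorem norm_innerBias_le (θ : Params m d) : ‖innerBias θ‖ ≤ ‖θ‖ := by
  refine le_of_sq_le_sq ?_ (norm_nonneg _)
  rw [norm_sq_params, EuclideanSpace.real_norm_sq_eq]
  have h1 : 0 ≤ ∑ ℓ, ‖weightRow θ ℓ‖ ^ 2 := by positivity
  have h2 : 0 ≤ ∑ ℓ, outerWeights θ ℓ ^ 2 := by positivity
  nlinarith [sq_nonneg (outerBias θ)]

/-- The three norms inside ξ are 1-Lipschitz in θ, so moving θ by O(√m) changes ξ by O(1) only. -/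
theorem xi_le_add (θ θ' : Params m d) : xi θ ≤ xi θ' + ‖θ - θ'‖ / Real.sqrt m := by
  have hdist : ∀ {u u' : ℝ}, u ≤ u' + ‖θ - θ'‖ →
      u / Real.sqrt m ≤ u' / Real.sqrt m + ‖θ - θ'‖ / Real.sqrt m := fun h => by
    rw [← add_div]; exact div_le_div_of_nonneg_right h (Real.sqrt_nonneg _)
  have hnn : 0 ≤ ‖θ - θ'‖ / Real.sqrt m := by positivity
  rw [xi]
  refine max_le ?_ (max_le ?_ (max_le ?_ (by linarith [one_le_xi θ'])))
  · refine (hdist (u' := matrixOpNorm (innerWeights θ')) ?_).trans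
      (add_le_add_left (le_max_left _ _) _)
    have h1 := matrixOpNorm_innerWeights_le (θ - θ')
    have h2 : innerWeights θ = innerWeights θ' + innerWeights (θ - θ') := by
      ext i j; simp [innerWeights]
    have h3 : matrixOpNorm (innerWeights θ) ≤
        matrixOpNorm (innerWeights θ') + matrixOpNorm (innerWeights (θ - θ')) := by
      rw [h2, matrixOpNorm, map_add, map_add]
      exact norm_add_le _ _
    linarith
  · refine (hdist (u' := ‖innerBias θ'‖) ?_).trans
      (add_le_add_left ((le_max_left _ _).trans (le_max_right _ _)) _)
    have h2 : innerBias θ = innerBias θ' + innerBias (θ - θ') := by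
      ext i; simp [innerBias]
    rw [h2]
    exact (norm_add_le _ _).trans (by gcongr; exact norm_innerBias_le _)
  · refine (hdist (u' := ‖outerWeights θ'‖) ?_).trans
      (add_le_add_left ((le_max_left _ _).trans ((le_max_right _ _).trans (le_max_right _ _))) _)
    have h2 : outerWeights θ = outerWeights θ' + outerWeights (θ - θ') := by
      ext i; simp [outerWeights]
    rw [h2]
    exact (norm_add_le _ _).trans (by gcongr; exact norm_outerWeights_le _)

/-! ### Size and Lipschitz bounds for the parameter gradient -/

/-- The block of activations, the blocks containing σ' and the output bias each contribute at most
D²ξ² to the squared norm. The factor 3 in D absorbs the loss in (a + b + c)² ≤ 3(a² + b² + c²). -/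
theorem norm_featureVec_le {σ : ℝ → ℝ} (hσ : Differentiable ℝ σ)
    (hσ₁ : ∃ B : ℝ, ∀ z, |deriv σ z| ≤ B) (hm : 0 < m) {M : ℝ} (θ : Params m d) {x : Input d}
    (hx : ‖x‖ ≤ M) : ‖featureVec σ θ x‖ ≤ 2 * constD σ M * xi θ := by
  obtain ⟨hD, hD0, hDM, hD1⟩ := constD_bounds σ M
  have hm' : (0 : ℝ) < m := by exact_mod_cast hm
  have hsq : 0 < Real.sqrt m := Real.sqrt_pos.2 hm'
  set D := constD σ M
  set L := supNorm (deriv σ) with hL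
  have hL0 : 0 ≤ L := supNorm_nonneg _
  have hM0 : 0 ≤ M := (norm_nonneg x).trans hx
  have hξ := one_le_xi θ
  set ξ := xi θ with hξdef
  have hW : ∑ ℓ, (inner ℝ (weightRow θ ℓ) x) ^ 2 ≤ m * (M * ξ) ^ 2 := by
    refine (sum_inner_weightRow_sq_le θ x).trans ?_
    have h1 : matrixOpNorm (innerWeights θ) ≤ ξ * Real.sqrt m := by
      rw [← div_le_iff₀ hsq]; exact le_max_left _ _
    have h2 : 0 ≤ matrixOpNorm (innerWeights θ) := norm_nonneg _
    calc (matrixOpNorm (innerWeights θ) * ‖x‖) ^ 2 ≤ (ξ * Real.sqrt m * M) ^ 2 := by gcongr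
      _ = m * (M * ξ) ^ 2 := by rw [mul_pow, mul_pow, Real.sq_sqrt hm'.le]; ring
  have hb : ∑ ℓ, innerBias θ ℓ ^ 2 ≤ m * ξ ^ 2 := by
    have h1 : ‖innerBias θ‖ ≤ ξ * Real.sqrt m := by
      rw [← div_le_iff₀ hsq]; exact (le_max_left _ _).trans (le_max_right _ _)
    rw [← EuclideanSpace.real_norm_sq_eq]
    calc _ ≤ (ξ * Real.sqrt m) ^ 2 := by gcongr
      _ = m * ξ ^ 2 := by rw [mul_pow, Real.sq_sqrt hm'.le]; ring
  have ha : ∑ ℓ, outerWeights θ ℓ ^ 2 ≤ m * ξ ^ 2 := by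
    have h1 : ‖outerWeights θ‖ ≤ ξ * Real.sqrt m := by
      rw [← div_le_iff₀ hsq]
      exact (le_max_left _ _).trans ((le_max_right _ _).trans (le_max_right _ _))
    rw [← EuclideanSpace.real_norm_sq_eq]
    calc _ ≤ (ξ * Real.sqrt m) ^ 2 := by gcongr
      _ = m * ξ ^ 2 := by rw [mul_pow, Real.sq_sqrt hm'.le]; ring
  have hnorm : ‖featureVec σ θ x‖ ^ 2 = (1 / m) * (∑ ℓ, σ (preActivation θ x ℓ) ^ 2 +
      (∑ ℓ, (outerWeights θ ℓ * deriv σ (preActivation θ x ℓ)) ^ 2) * (‖x‖ ^ 2 + 1)) + 1 := by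
    rw [EuclideanSpace.real_norm_sq_eq, EuclideanSpace.real_norm_sq_eq]
    simp only [Fintype.sum_sum_type, Fintype.sum_prod_type, featureVec, Sum.elim_inl, Sum.elim_inr,
      mul_pow, div_pow, Real.sq_sqrt hm'.le, Finset.univ_unique, Finset.sum_singleton, one_pow,
      ← Finset.mul_sum, ← Finset.sum_mul, ← Finset.sum_div]
    ring
  have h1 : ∑ ℓ, σ (preActivation θ x ℓ) ^ 2 ≤ m * (D ^ 2 * ξ ^ 2) := by
    have hpt : ∀ ℓ, σ (preActivation θ x ℓ) ^ 2 ≤ 3 * (σ 0 ^ 2 +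
        L ^ 2 * (inner ℝ (weightRow θ ℓ) x) ^ 2 + L ^ 2 * innerBias θ ℓ ^ 2) := by
      intro ℓ
      have h := abs_sub_le_supNorm_deriv_mul hσ hσ₁ (preActivation θ x ℓ) 0
      rw [sub_zero, ← hL] at h
      have h2 : |σ (preActivation θ x ℓ)| ≤
          |σ 0| + L * |inner ℝ (weightRow θ ℓ) x| + L * |innerBias θ ℓ| := by
        have h3 := abs_sub_abs_le_abs_sub (σ (preActivation θ x ℓ)) (σ 0)
        have h4 : L * |preActivation θ x ℓ| ≤
            L * (|inner ℝ (weightRow θ ℓ) x| + |innerBias θ ℓ|) :=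
          mul_le_mul_of_nonneg_left (abs_add_le _ _) hL0
        linarith
      have h5 := pow_le_pow_left₀ (abs_nonneg _) h2 2
      rw [sq_abs] at h5
      rw [← sq_abs (σ 0), ← sq_abs (inner ℝ (weightRow θ ℓ) x), ← sq_abs (innerBias θ ℓ)]
      nlinarith [sq_nonneg (|σ 0| - L * |inner ℝ (weightRow θ ℓ) x|),
        sq_nonneg (|σ 0| - L * |innerBias θ ℓ|),
        sq_nonneg (L * |inner ℝ (weightRow θ ℓ) x| - L * |innerBias θ ℓ|)]
    refine (Finset.sum_le_sum fun ℓ _ => hpt ℓ).trans ?_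
    rw [← Finset.mul_sum, Finset.sum_add_distrib, Finset.sum_add_distrib, ← Finset.mul_sum,
      ← Finset.mul_sum, Finset.sum_const, Finset.card_univ, Fintype.card_fin, nsmul_eq_mul]
    have h3 : σ 0 ^ 2 ≤ (D / 3) ^ 2 * ξ ^ 2 := by
      rw [← sq_abs, ← mul_pow]
      refine pow_le_pow_left₀ (abs_nonneg _) (hD0.trans ?_) 2
      nlinarith
    have h4 : L ^ 2 * ∑ ℓ, (inner ℝ (weightRow θ ℓ) x) ^ 2 ≤ m * ((D / 3) ^ 2 * ξ ^ 2) := by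
      calc _ ≤ L ^ 2 * (m * (M * ξ) ^ 2) := by gcongr
        _ = m * ((M * L) ^ 2 * ξ ^ 2) := by ring
        _ ≤ _ := by gcongr
    have h5 : L ^ 2 * ∑ ℓ, innerBias θ ℓ ^ 2 ≤ m * ((D / 3) ^ 2 * ξ ^ 2) := by
      calc _ ≤ L ^ 2 * (m * ξ ^ 2) := by gcongr
        _ = m * (L ^ 2 * ξ ^ 2) := by ring
        _ ≤ _ := by gcongr
    have h6 : m * σ 0 ^ 2 ≤ m * ((D / 3) ^ 2 * ξ ^ 2) := by gcongr
    nlinarith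
  have h2 : (∑ ℓ, (outerWeights θ ℓ * deriv σ (preActivation θ x ℓ)) ^ 2) * (‖x‖ ^ 2 + 1) ≤
      m * (D ^ 2 * ξ ^ 2) := by
    have h3 : ∑ ℓ, (outerWeights θ ℓ * deriv σ (preActivation θ x ℓ)) ^ 2 ≤ L ^ 2 * (m * ξ ^ 2) := by
      calc _ ≤ ∑ ℓ, L ^ 2 * outerWeights θ ℓ ^ 2 := by
            refine Finset.sum_le_sum fun ℓ _ => ?_
            rw [mul_pow, mul_comm, ← sq_abs (deriv σ _)]
            gcongr
            exact abs_le_supNorm hσ₁ _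
        _ = L ^ 2 * ∑ ℓ, outerWeights θ ℓ ^ 2 := by rw [Finset.mul_sum]
        _ ≤ _ := by gcongr
    calc _ ≤ L ^ 2 * (m * ξ ^ 2) * (M ^ 2 + 1) := by gcongr
      _ = m * (((M * L) ^ 2 + L ^ 2) * ξ ^ 2) := by ring
      _ ≤ m * (((D / 3) ^ 2 + (D / 3) ^ 2) * ξ ^ 2) := by gcongr
      _ ≤ _ := by gcongr; nlinarith
  refine le_of_sq_le_sq ?_ (by positivity)
  rw [hnorm]
  have h3 : (1 / (m : ℝ)) * (∑ ℓ, σ (preActivation θ x ℓ) ^ 2 +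
      (∑ ℓ, (outerWeights θ ℓ * deriv σ (preActivation θ x ℓ)) ^ 2) * (‖x‖ ^ 2 + 1)) ≤
      2 * (D ^ 2 * ξ ^ 2) := by
    rw [one_div, inv_mul_le_iff₀ hm']
    linarith
  have h4 : 1 ≤ D ^ 2 * ξ ^ 2 := by
    rw [← mul_pow]
    exact one_le_pow₀ (by nlinarith)
  nlinarith

/-- The Lipschitz constant of the parameter gradient, up to the factor `‖a‖_∞ / √m`. -/
noncomputable def gradLip (σ : ℝ → ℝ) (M : ℝ) : ℝ :=
  2 * (1 + M ^ 2) * (supNorm (deriv σ) + supNorm (deriv (deriv σ)))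

theorem gradLip_nonneg (σ : ℝ → ℝ) (M : ℝ) : 0 ≤ gradLip σ M :=
  mul_nonneg (by positivity) (add_nonneg (supNorm_nonneg _) (supNorm_nonneg _))

/-- In aσ'(z) - a'σ'(z') = (a - a')σ'(z) + a'(σ'(z) - σ'(z')) only a' needs a sup-norm bound. With
θ' = θ₀ this requires ξ̃(0) alone, and no entrywise control along the trajectory. -/
theorem norm_featureVec_sub_le {σ : ℝ → ℝ} (hσ : ContDiff ℝ 2 σ)
    (hσ₁ : ∃ B : ℝ, ∀ z, |deriv σ z| ≤ B) (hσ₂ : ∃ B : ℝ, ∀ z, |deriv (deriv σ) z| ≤ B)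
    {M α : ℝ} (hα : 1 ≤ α) (θ θ' : Params m d) (hθ' : ∀ ℓ, |outerWeights θ' ℓ| ≤ α)
    {x : Input d} (hx : ‖x‖ ≤ M) :
    ‖featureVec σ θ x - featureVec σ θ' x‖ ≤
      gradLip σ M * α / Real.sqrt m * ‖θ - θ'‖ := by
  have hd1 : Differentiable ℝ σ := hσ.differentiable (by norm_num)
  have hd2 : Differentiable ℝ (deriv σ) :=
    (((contDiff_succ_iff_deriv (n := 1)).1 (by simpa [one_add_one_eq_two] using hσ)).2.2).differentiable
      (by norm_num)
  set L := supNorm (deriv σ) with hL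
  set L' := supNorm (deriv (deriv σ)) with hL'
  have hL0 : 0 ≤ L := supNorm_nonneg _
  have hL0' : 0 ≤ L' := supNorm_nonneg _
  have hM0 : 0 ≤ M := (norm_nonneg x).trans hx
  set z := preActivation θ x
  set z' := preActivation θ' x
  have hnorm : ‖featureVec σ θ x - featureVec σ θ' x‖ ^ 2 = (∑ ℓ, (σ (z ℓ) - σ (z' ℓ)) ^ 2 +
      (∑ ℓ, (outerWeights θ ℓ * deriv σ (z ℓ) - outerWeights θ' ℓ * deriv σ (z' ℓ)) ^ 2) *
        (‖x‖ ^ 2 + 1)) / m := by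
    rw [EuclideanSpace.real_norm_sq_eq, EuclideanSpace.real_norm_sq_eq]
    simp only [Fintype.sum_sum_type, Fintype.sum_prod_type, featureVec, Sum.elim_inl, Sum.elim_inr,
      PiLp.sub_apply, ← sub_div, ← sub_mul, mul_pow, div_pow, Real.sq_sqrt (Nat.cast_nonneg m),
      Finset.univ_unique, Finset.sum_singleton,
      ← Finset.mul_sum, ← Finset.sum_mul, ← Finset.sum_div]
    ring
  set R := ‖θ - θ'‖ with hR
  have hRsq := norm_sq_params (θ - θ')
  rw [← hR] at hRsq
  have hp1 : 0 ≤ ∑ ℓ, outerWeights (θ - θ') ℓ ^ 2 :=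
    Finset.sum_nonneg fun _ _ => sq_nonneg _
  have hp2 : 0 ≤ ∑ ℓ, ‖weightRow (θ - θ') ℓ‖ ^ 2 :=
    Finset.sum_nonneg fun _ _ => sq_nonneg _
  have hp3 : 0 ≤ ∑ ℓ, innerBias (θ - θ') ℓ ^ 2 :=
    Finset.sum_nonneg fun _ _ => sq_nonneg _
  have hz : ∑ ℓ, (z ℓ - z' ℓ) ^ 2 ≤ 2 * (1 + M ^ 2) * R ^ 2 := by
    have hpt : ∀ ℓ, (z ℓ - z' ℓ) ^ 2 ≤
        2 * (1 + M ^ 2) * (‖weightRow (θ - θ') ℓ‖ ^ 2 + innerBias (θ - θ') ℓ ^ 2) := by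
      intro ℓ
      rw [← preActivation_sub, preActivation]
      have h1 : (inner ℝ (weightRow (θ - θ') ℓ) x) ^ 2 ≤ (‖weightRow (θ - θ') ℓ‖ * M) ^ 2 :=
        sq_le_sq.2 (((abs_real_inner_le_norm _ _).trans
          (mul_le_mul_of_nonneg_left hx (norm_nonneg _))).trans (le_abs_self _))
      generalize inner ℝ (weightRow (θ - θ') ℓ) x = p at *
      generalize innerBias (θ - θ') ℓ = q at *
      generalize ‖weightRow (θ - θ') ℓ‖ = w at *
      nlinarith [sq_nonneg (p - q), sq_nonneg w, mul_nonneg (sq_nonneg M) (sq_nonneg q)]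
    refine (Finset.sum_le_sum fun ℓ _ => hpt ℓ).trans ?_
    rw [← Finset.mul_sum, Finset.sum_add_distrib]
    gcongr
    nlinarith [sq_nonneg (outerBias (θ - θ'))]
  have h1 : ∑ ℓ, (σ (z ℓ) - σ (z' ℓ)) ^ 2 ≤ L ^ 2 * (2 * (1 + M ^ 2) * R ^ 2) := by
    calc _ ≤ ∑ ℓ, L ^ 2 * (z ℓ - z' ℓ) ^ 2 := by
          refine Finset.sum_le_sum fun ℓ _ => ?_
          rw [← sq_abs, ← sq_abs (z ℓ - z' ℓ), ← mul_pow]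
          exact pow_le_pow_left₀ (abs_nonneg _) (abs_sub_le_supNorm_deriv_mul hd1 hσ₁ _ _) 2
      _ = L ^ 2 * ∑ ℓ, (z ℓ - z' ℓ) ^ 2 := by rw [Finset.mul_sum]
      _ ≤ _ := by gcongr
  have h2 : ∑ ℓ, (outerWeights θ ℓ * deriv σ (z ℓ) - outerWeights θ' ℓ * deriv σ (z' ℓ)) ^ 2 ≤
      2 * L ^ 2 * R ^ 2 + 2 * α ^ 2 * L' ^ 2 * (2 * (1 + M ^ 2) * R ^ 2) := by
    have hpt : ∀ ℓ, (outerWeights θ ℓ * deriv σ (z ℓ) - outerWeights θ' ℓ * deriv σ (z' ℓ)) ^ 2 ≤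
        2 * L ^ 2 * outerWeights (θ - θ') ℓ ^ 2 + 2 * α ^ 2 * L' ^ 2 * (z ℓ - z' ℓ) ^ 2 := by
      intro ℓ
      have e1 : outerWeights θ ℓ * deriv σ (z ℓ) - outerWeights θ' ℓ * deriv σ (z' ℓ) =
          outerWeights (θ - θ') ℓ * deriv σ (z ℓ) +
            outerWeights θ' ℓ * (deriv σ (z ℓ) - deriv σ (z' ℓ)) := by
        have : outerWeights (θ - θ') ℓ = outerWeights θ ℓ - outerWeights θ' ℓ := by
          simp [outerWeights]
        rw [this]; ring
      have e2 : (outerWeights (θ - θ') ℓ * deriv σ (z ℓ)) ^ 2 ≤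
          L ^ 2 * outerWeights (θ - θ') ℓ ^ 2 := by
        rw [mul_pow, mul_comm, ← sq_abs (deriv σ _)]
        gcongr
        exact abs_le_supNorm hσ₁ _
      have e3 : (outerWeights θ' ℓ * (deriv σ (z ℓ) - deriv σ (z' ℓ))) ^ 2 ≤
          α ^ 2 * (L' ^ 2 * (z ℓ - z' ℓ) ^ 2) := by
        rw [mul_pow, ← sq_abs (outerWeights θ' ℓ)]
        refine mul_le_mul (pow_le_pow_left₀ (abs_nonneg _) (hθ' ℓ) 2) ?_ (sq_nonneg _) (sq_nonneg _)
        rw [← sq_abs, ← sq_abs (z ℓ - z' ℓ), ← mul_pow]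
        exact pow_le_pow_left₀ (abs_nonneg _) (abs_sub_le_supNorm_deriv_mul hd2 hσ₂ _ _) 2
      rw [e1]
      nlinarith [sq_nonneg (outerWeights (θ - θ') ℓ * deriv σ (z ℓ) -
        outerWeights θ' ℓ * (deriv σ (z ℓ) - deriv σ (z' ℓ)))]
    refine (Finset.sum_le_sum fun ℓ _ => hpt ℓ).trans ?_
    rw [Finset.sum_add_distrib, ← Finset.mul_sum, ← Finset.mul_sum]
    gcongr
    nlinarith [sq_nonneg (outerBias (θ - θ'))]
  have hmain : ∑ ℓ, (σ (z ℓ) - σ (z' ℓ)) ^ 2 +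
      (∑ ℓ, (outerWeights θ ℓ * deriv σ (z ℓ) - outerWeights θ' ℓ * deriv σ (z' ℓ)) ^ 2) *
        (‖x‖ ^ 2 + 1) ≤ (gradLip σ M * α * R) ^ 2 := by
    have h3 : ‖x‖ ^ 2 + 1 ≤ 1 + M ^ 2 := by
      have := pow_le_pow_left₀ (norm_nonneg x) hx 2
      linarith
    have hα2 : 1 ≤ α ^ 2 := one_le_pow₀ hα
    set u := 1 + M ^ 2 with hu
    have hu1 : 1 ≤ u := by nlinarith [sq_nonneg M]
    calc _ ≤ L ^ 2 * (2 * u * R ^ 2) +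
          (2 * L ^ 2 * R ^ 2 + 2 * α ^ 2 * L' ^ 2 * (2 * u * R ^ 2)) * u := by gcongr
      -- The ones are placeholders that the next line enlarges to u and α²; the cross term added
      -- afterwards completes the square (L + L')².
      _ = 4 * u * 1 * 1 * L ^ 2 * R ^ 2 + 4 * α ^ 2 * u ^ 2 * L' ^ 2 * R ^ 2 := by ring
      _ ≤ 4 * u * u * α ^ 2 * L ^ 2 * R ^ 2 + 4 * α ^ 2 * u ^ 2 * L' ^ 2 * R ^ 2 := by gcongr
      _ ≤ 4 * u * u * α ^ 2 * L ^ 2 * R ^ 2 + 4 * α ^ 2 * u ^ 2 * L' ^ 2 * R ^ 2 +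
          4 * α ^ 2 * u ^ 2 * R ^ 2 * (2 * L * L') := by
        have : 0 ≤ 4 * α ^ 2 * u ^ 2 * R ^ 2 * (2 * L * L') := by positivity
        linarith
      _ = _ := by rw [gradLip]; ring
  have hg := gradLip_nonneg σ M
  refine le_of_sq_le_sq ?_ (by positivity)
  rw [hnorm]
  calc _ ≤ (gradLip σ M * α * R) ^ 2 / m := by gcongr
    _ = (gradLip σ M * α / Real.sqrt m * R) ^ 2 := by
      rw [div_mul_eq_mul_div, div_pow, Real.sq_sqrt (Nat.cast_nonneg m)]

/-! ### The largest eigenvalue and ‖B‖² -/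

section Eigen

variable {H : Type*} [NormedAddCommGroup H] [InnerProductSpace ℝ H] [CompleteSpace H]

/-- Otherwise v is orthogonal to every φ i, yet it lies in their span by exhaustion. -/
theorem IsEigenEnumeration.exists_eq_of_eigenvector {A : H →L[ℝ] H} (hA : IsSelfAdjoint A) {N : ℕ}
    {s : Fin N → ℝ} {φ : Fin N → H} (h : IsEigenEnumeration A s φ) {c : ℝ} (hc : c ≠ 0) {v : H}
    (hv : v ≠ 0) (hAv : A v = c • v) : ∃ i, s i = c := by
  by_contra! hne
  have horth : ∀ i, inner ℝ (φ i) v = 0 := by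
    intro i
    have h1 : inner ℝ (A (φ i)) v = inner ℝ (φ i) (A v) := hA.isSymmetric _ _
    rw [h.eigen, hAv, inner_smul_left, inner_smul_right] at h1
    have h2 : (s i - c) * inner ℝ (φ i) v = 0 := by
      simp only [conj_trivial] at h1
      linarith
    exact (mul_eq_zero.1 h2).resolve_left (sub_ne_zero.2 (hne i))
  have hmem := h.exhaust c hc v hAv
  have h3 : ∀ w ∈ Submodule.span ℝ (range φ), inner ℝ w v = 0 := by
    intro w hw
    induction hw using Submodule.span_induction with
    | mem w hw => obtain ⟨i, rfl⟩ := hw; exact horth i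
    | zero => simp
    | add a b _ _ ha hb => rw [inner_add_left, ha, hb, add_zero]
    | smul a w _ hw => rw [inner_smul_left, hw, mul_zero]
  exact hv (inner_self_eq_zero.1 (h3 v hmem))

/-- If `A = B B†` with `B` defined on a finite-dimensional space, then `‖B‖² ≤ σ₁`, the largest
nonzero eigenvalue of `A`. -/
theorem IsEigenEnumeration.norm_apply_le {V : Type*} [NormedAddCommGroup V]
    [InnerProductSpace ℝ V] [FiniteDimensional ℝ V] (B : V →L[ℝ] H) {N : ℕ} {s : Fin N → ℝ}
    {φ : Fin N → H} (h : IsEigenEnumeration (B ∘L ContinuousLinearMap.adjoint B) s φ) (v : V) :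
    ‖B v‖ ≤ Real.sqrt (⨆ i, s i) * ‖v‖ := by
  rcases eq_or_ne v 0 with rfl | hv0
  · simp
  have : Nontrivial V := ⟨⟨v, 0, hv0⟩⟩
  set B' := ContinuousLinearMap.adjoint B with hB'
  have hA : IsSelfAdjoint (B ∘L B') := by
    rw [ContinuousLinearMap.isSelfAdjoint_iff_isSymmetric]
    intro x y
    change inner ℝ (B (B' x)) y = inner ℝ x (B (B' y))
    rw [hB', ← ContinuousLinearMap.adjoint_inner_right, ContinuousLinearMap.adjoint_inner_left]
  have hinner : ∀ x : V, inner ℝ (B' (B x)) x = ‖B x‖ ^ 2 := fun x => by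
    rw [hB', ContinuousLinearMap.adjoint_inner_left, real_inner_self_eq_norm_sq]
  have hS : ((B' ∘L B : V →L[ℝ] V) : V →ₗ[ℝ] V).IsSymmetric := by
    intro x y
    change inner ℝ (B' (B x)) y = inner ℝ x (B' (B y))
    rw [hB', ContinuousLinearMap.adjoint_inner_left, ContinuousLinearMap.adjoint_inner_right]
  have hs0 : ∀ i, 0 ≤ s i := by
    intro i
    have h1 : inner ℝ ((B ∘L B') (φ i)) (φ i) = ‖B' (φ i)‖ ^ 2 := by
      change inner ℝ (B (B' (φ i))) (φ i) = _
      rw [← real_inner_self_eq_norm_sq]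
      nth_rewrite 3 [hB']
      rw [ContinuousLinearMap.adjoint_inner_right]
    rw [h.eigen, inner_smul_left, real_inner_self_eq_norm_sq, h.orthonormal.1 i] at h1
    simp only [conj_trivial, one_pow, mul_one] at h1
    rw [h1]; positivity
  have hσ0 : 0 ≤ ⨆ i, s i := Real.iSup_nonneg hs0
  -- The supremum of ‖Bx‖²/‖x‖² is an eigenvalue of B†B. If it is positive, B carries an eigenvector
  -- to an eigenvector of BB† for the same value; if it is zero nothing is needed, which includes N
  -- = 0, where `⨆ i, s i` is 0.
  have heig := hS.hasEigenvalue_iSup_of_finiteDimensional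
  have hray : ∀ x : V, RCLike.re (inner ℝ (((B' ∘L B : V →L[ℝ] V) : V →ₗ[ℝ] V) x) x) = ‖B x‖ ^ 2 :=
    fun x => hinner x
  simp only [hray] at heig
  set c : ℝ := ⨆ x : { x : V // x ≠ 0 }, ‖B x‖ ^ 2 / ‖(x : V)‖ ^ 2 with hc
  have hbdd : BddAbove (range fun x : { x : V // x ≠ 0 } => ‖B x‖ ^ 2 / ‖(x : V)‖ ^ 2) := by
    refine ⟨‖B‖ ^ 2, ?_⟩
    rintro _ ⟨x, rfl⟩
    have hx : 0 < ‖(x : V)‖ := norm_pos_iff.2 x.2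
    change ‖B x‖ ^ 2 / ‖(x : V)‖ ^ 2 ≤ _
    rw [div_le_iff₀ (by positivity), ← mul_pow]
    exact pow_le_pow_left₀ (norm_nonneg _) (B.le_opNorm _) 2
  have hle : ‖B v‖ ^ 2 / ‖v‖ ^ 2 ≤ c :=
    le_ciSup (f := fun x : { x : V // x ≠ 0 } => ‖B x‖ ^ 2 / ‖(x : V)‖ ^ 2) hbdd ⟨v, hv0⟩
  have hcσ : c ≤ ⨆ i, s i := by
    rcases le_or_gt c 0 with hc0 | hc0
    · exact hc0.trans hσ0
    obtain ⟨w, hw⟩ := heig.exists_hasEigenvector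
    have hw1 : B' (B w) = c • w := hw.apply_eq_smul
    have hw2 : B w ≠ 0 := by
      intro h0
      rw [h0, map_zero] at hw1
      exact (smul_ne_zero hc0.ne' hw.2) hw1.symm
    obtain ⟨i, hi⟩ := h.exists_eq_of_eigenvector hA hc0.ne' hw2
      (by change B (B' (B w)) = _; rw [hw1, map_smul])
    rw [← hi]
    exact le_ciSup (Set.finite_range s).bddAbove i
  have hvpos : 0 < ‖v‖ := norm_pos_iff.2 hv0
  refine le_of_sq_le_sq ?_ (by positivity)
  rw [mul_pow, Real.sq_sqrt hσ0, ← div_le_iff₀ (by positivity)]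
  exact hle.trans hcσ

end Eigen

/-! ### Taylor and Lipschitz estimates for the network -/

section Network

/-- Mean value inequality for the network minus its linearization, on the ball of radius ‖θ' - θ‖
around θ. -/
theorem abs_network_sub_sub_inner_le {σ : ℝ → ℝ} (hσ : ContDiff ℝ 2 σ)
    (hσ₁ : ∃ B : ℝ, ∀ z, |deriv σ z| ≤ B) (hσ₂ : ∃ B : ℝ, ∀ z, |deriv (deriv σ) z| ≤ B)
    {M : ℝ} (θ θ' : Params m d) {x : Input d} (hx : ‖x‖ ≤ M) :
    |network σ θ' x - network σ θ x - inner ℝ (featureVec σ θ x) (θ' - θ)| ≤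
      gradLip σ M * xiTilde θ / Real.sqrt m * ‖θ' - θ‖ * ‖θ' - θ‖ := by
  have hd1 : Differentiable ℝ σ := hσ.differentiable (by norm_num)
  have hg := gradLip_nonneg σ M
  have hξ := one_le_xiTilde θ
  have h := Convex.norm_image_sub_le_of_norm_hasFDerivWithin_le'
    (f := fun η : Params m d => network σ η x)
    (f' := fun η => InnerProductSpace.toDual ℝ (Params m d) (featureVec σ η x))
    (φ := InnerProductSpace.toDual ℝ (Params m d) (featureVec σ θ x))
    (C := gradLip σ M * xiTilde θ / Real.sqrt m * ‖θ' - θ‖)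
    (s := Metric.closedBall θ ‖θ' - θ‖)
    (fun η _ => (hasGradientAt_network hd1 η x).hasFDerivAt.hasFDerivWithinAt)
    (fun η hη => by
      rw [← map_sub, LinearIsometryEquiv.norm_map]
      refine (norm_featureVec_sub_le hσ hσ₁ hσ₂ hξ η θ
        (abs_outerWeights_le_xiTilde θ) hx).trans ?_
      rw [Metric.mem_closedBall, dist_eq_norm] at hη
      gcongr)
    (convex_closedBall _ _) (Metric.mem_closedBall_self (norm_nonneg _))
    (by rw [Metric.mem_closedBall, dist_eq_norm])
  simpa using h

theorem abs_network_sub_le {σ : ℝ → ℝ} (hσ : Differentiable ℝ σ) {s : Set (Params m d)}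
    (hs : Convex ℝ s) {x : Input d} {B : ℝ} (hB : ∀ η ∈ s, ‖featureVec σ η x‖ ≤ B)
    {θ θ' : Params m d} (hθ : θ ∈ s) (hθ' : θ' ∈ s) :
    |network σ θ' x - network σ θ x| ≤ B * ‖θ' - θ‖ :=
  Convex.norm_image_sub_le_of_norm_hasFDerivWithin_le
    (f := fun η : Params m d => network σ η x)
    (f' := fun η => InnerProductSpace.toDual ℝ (Params m d) (featureVec σ η x))
    (fun η _ => (hasGradientAt_network hσ η x).hasFDerivAt.hasFDerivWithinAt)
    (fun η hη => by rw [LinearIsometryEquiv.norm_map]; exact hB η hη) hs hθ hθ'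

end Network

theorem norm_toLp_le_of_abs_le {X : Set (Input d)} (ρ : Measure X)
    [IsProbabilityMeasure ρ] {f : X → ℝ} (hf : MemLp f 2 ρ) {B : ℝ} (hB : 0 ≤ B)
    (h : ∀ x, |f x| ≤ B) : ‖hf.toLp f‖ ≤ B := by
  have := Lp.norm_le_of_ae_bound (f := hf.toLp f) hB (by
    filter_upwards [hf.coeFn_toLp] with y hy
    rw [hy]
    exact h y)
  simpa [measureUnivNNReal] using this

/-! ### The linearized network as an operator into L² -/

section L2

variable {X : Set (Input d)} [CompactSpace X] (ρ : Measure X) [IsProbabilityMeasure ρ]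

theorem memLp_inner_featureVec {σ : ℝ → ℝ} (hσ : ContDiff ℝ 2 σ) (θ v : Params m d) :
    MemLp (fun x : X => inner ℝ (featureVec σ θ (x : Input d)) v) 2 ρ := by
  have hc : Continuous fun x : X => inner ℝ (featureVec σ θ (x : Input d)) v :=
    ((continuous_featureVec hσ θ).comp continuous_subtype_val).inner continuous_const
  obtain ⟨B, hB⟩ := isCompact_univ.exists_bound_of_continuousOn hc.continuousOn
  exact MemLp.of_bound hc.aestronglyMeasurable B
    (Filter.Eventually.of_forall fun x => hB x (mem_univ _))

/-- The linearization `v ↦ ⟨∂_θ f(·; θ), v⟩` of the network, as an operator into `L²(X, ρ)`. -/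
noncomputable def featureOp {σ : ℝ → ℝ} (hσ : ContDiff ℝ 2 σ) (θ : Params m d) :
    Params m d →L[ℝ] Lp ℝ 2 ρ :=
  LinearMap.toContinuousLinearMap
    { toFun := fun v => (memLp_inner_featureVec ρ hσ θ v).toLp _
      map_add' := fun v w => by
        rw [← MemLp.toLp_add]
        exact MemLp.toLp_congr _ _ (Filter.Eventually.of_forall fun x => inner_add_right _ _ _)
      map_smul' := fun c v => by
        rw [RingHom.id_apply, ← MemLp.toLp_const_smul]
        exact MemLp.toLp_congr _ _ (Filter.Eventually.of_forall fun x => real_inner_smul_right _ _ _) }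

theorem featureOp_apply {σ : ℝ → ℝ} (hσ : ContDiff ℝ 2 σ) (θ v : Params m d) :
    featureOp ρ hσ θ v = (memLp_inner_featureVec ρ hσ θ v).toLp _ := rfl

theorem featureOp_coeFn {σ : ℝ → ℝ} (hσ : ContDiff ℝ 2 σ) (θ v : Params m d) :
    featureOp ρ hσ θ v =ᵐ[ρ] fun x => inner ℝ (featureVec σ θ (x : Input d)) v :=
  (memLp_inner_featureVec ρ hσ θ v).coeFn_toLp

theorem norm_featureOp_apply_le {σ : ℝ → ℝ} (hσ : ContDiff ℝ 2 σ) (θ v : Params m d) {B : ℝ}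
    (hB0 : 0 ≤ B) (hB : ∀ x : X, ‖featureVec σ θ (x : Input d)‖ ≤ B) :
    ‖featureOp ρ hσ θ v‖ ≤ B * ‖v‖ :=
  norm_toLp_le_of_abs_le ρ (memLp_inner_featureVec ρ hσ θ v) (by positivity) fun x =>
    (abs_real_inner_le_norm _ _).trans (mul_le_mul_of_nonneg_right (hB x) (norm_nonneg _))

theorem norm_featureOp_apply_sub_le {σ : ℝ → ℝ} (hσ : ContDiff ℝ 2 σ) (θ θ' v : Params m d) {B : ℝ}
    (hB0 : 0 ≤ B)
    (hB : ∀ x : X, ‖featureVec σ θ (x : Input d) - featureVec σ θ' (x : Input d)‖ ≤ B) :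
    ‖featureOp ρ hσ θ v - featureOp ρ hσ θ' v‖ ≤ B * ‖v‖ := by
  rw [featureOp_apply, featureOp_apply, ← MemLp.toLp_sub]
  refine norm_toLp_le_of_abs_le ρ _ (by positivity) fun x => ?_
  rw [Pi.sub_apply, ← inner_sub_left]
  exact (abs_real_inner_le_norm _ _).trans (mul_le_mul_of_nonneg_right (hB x) (norm_nonneg _))

theorem inner_adjoint_featureOp {σ : ℝ → ℝ} (hσ : ContDiff ℝ 2 σ) (θ v : Params m d)
    (h : Lp ℝ 2 ρ) :
    inner ℝ v (ContinuousLinearMap.adjoint (featureOp ρ hσ θ) h) =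
      ∫ x : X, inner ℝ (featureVec σ θ (x : Input d)) v * h x ∂ρ := by
  rw [ContinuousLinearMap.adjoint_inner_right, L2.inner_def]
  refine integral_congr_ae ?_
  filter_upwards [featureOp_coeFn ρ hσ θ v] with x hx
  rw [hx]
  simp [mul_comm]

/-- The kernel is an inner product of features, so it can be pulled out of the integral. This
factorization supplies self-adjointness, positivity and the bound ‖Ψ_0‖² ≤ σ₁. -/
theorem ntkOperator_eq {σ : ℝ → ℝ} (hσ : ContDiff ℝ 2 σ) (θ : Params m d) :
    ntkOperator ρ hσ θ =
      featureOp ρ hσ θ ∘L ContinuousLinearMap.adjoint (featureOp ρ hσ θ) := by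
  ext1 h
  refine Lp.ext ?_
  refine (integralOperator_coeFn ρ _ (continuous_ntk hσ θ X) h).trans ?_
  refine Filter.EventuallyEq.trans ?_ (featureOp_coeFn ρ hσ θ
    (ContinuousLinearMap.adjoint (featureOp ρ hσ θ) h)).symm
  refine Filter.Eventually.of_forall fun x => ?_
  change ∫ s, ntk σ θ (x : Input d) (s : Input d) * h s ∂ρ = _
  refine Eq.trans ?_ (inner_adjoint_featureOp ρ hσ θ (featureVec σ θ (x : Input d)) h).symm
  refine integral_congr_ae (Filter.Eventually.of_forall fun s => ?_)
  simp only [ntk_eq_inner (hσ.differentiable (by norm_num)), real_inner_comm]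

theorem inner_adjoint_featureOp_residual {σ : ℝ → ℝ} (hσ : ContDiff ℝ 2 σ) {fstar : X → ℝ}
    (hf : MemLp fstar ∞ ρ) (θ η v : Params m d) :
    inner ℝ v (ContinuousLinearMap.adjoint (featureOp ρ hσ θ) (residual ρ hσ hf η)) =
      ∫ x : X, inner ℝ (featureVec σ θ (x : Input d)) v *
        (network σ η (x : Input d) - fstar x) ∂ρ := by
  rw [inner_adjoint_featureOp]
  refine integral_congr_ae ?_
  filter_upwards [(memLp_residual ρ hσ hf η).coeFn_toLp] with x hx
  rw [residual, hx]

/-- The Taylor remainder is quadratic uniformly in x ∈ X, so the pointwise derivative is also the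
derivative in L². -/
theorem hasFDerivAt_residual {σ : ℝ → ℝ} (hσ : ContDiff ℝ 2 σ)
    (hσ₁ : ∃ B : ℝ, ∀ z, |deriv σ z| ≤ B) (hσ₂ : ∃ B : ℝ, ∀ z, |deriv (deriv σ) z| ≤ B)
    {M : ℝ} (hX : ∀ x ∈ X, ‖x‖ ≤ M) {fstar : X → ℝ} (hf : MemLp fstar ∞ ρ) (θ : Params m d) :
    HasFDerivAt (residual ρ hσ hf) (featureOp ρ hσ θ) θ := by
  set c := gradLip σ M * xiTilde θ / Real.sqrt m with hc
  have hc0 : 0 ≤ c := by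
    have hg := gradLip_nonneg σ M
    have hξ := one_le_xiTilde θ
    positivity
  have hbound : ∀ θ' : Params m d, ‖residual ρ hσ hf θ' - residual ρ hσ hf θ -
      featureOp ρ hσ θ (θ' - θ)‖ ≤ c * ‖θ' - θ‖ * ‖θ' - θ‖ := by
    intro θ'
    rw [residual, residual, featureOp_apply, ← MemLp.toLp_sub, ← MemLp.toLp_sub]
    refine norm_toLp_le_of_abs_le ρ _ (by positivity) fun x => ?_
    have h := abs_network_sub_sub_inner_le hσ hσ₁ hσ₂ θ θ' (hX x x.2)
    simp only [Pi.sub_apply]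
    rwa [sub_sub_sub_cancel_right]
  rw [hasFDerivAt_iff_isLittleO]
  have hO : (fun θ' => residual ρ hσ hf θ' - residual ρ hσ hf θ - featureOp ρ hσ θ (θ' - θ))
      =O[nhds θ] fun θ' => ‖θ' - θ‖ * ‖θ' - θ‖ := by
    refine Asymptotics.IsBigO.of_bound c (Filter.Eventually.of_forall fun θ' => ?_)
    rw [norm_mul, norm_norm, ← mul_assoc]
    exact hbound θ'
  have ho : (fun θ' : Params m d => ‖θ' - θ‖ * ‖θ' - θ‖) =o[nhds θ] fun θ' => θ' - θ := by
    have h0 : Filter.Tendsto (fun θ' : Params m d => ‖θ' - θ‖) (nhds θ) (nhds 0) := by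
      have : Continuous fun θ' : Params m d => ‖θ' - θ‖ := by fun_prop
      simpa using this.tendsto θ
    have h1 := (Asymptotics.isLittleO_one_iff ℝ).2 h0
    have h2 := h1.mul_isBigO (Asymptotics.isBigO_refl (fun θ' : Params m d => ‖θ' - θ‖) (nhds θ))
    simp only [one_mul] at h2
    exact h2.of_norm_right
  exact hO.trans_isLittleO ho

end L2

/-! ### The training loss and its decay -/

section Loss

variable {X : Set (Input d)} {σ : ℝ → ℝ} {fstar : X → ℝ} {n : ℕ}

theorem empResidualSq_nonneg (x : Fin n → X) (θ : Params m d) : 0 ≤ empResidualSq σ fstar x θ :=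
  mul_nonneg (by positivity) (Finset.sum_nonneg fun _ _ => sq_nonneg _)

theorem hasGradientAt_loss (hσ : Differentiable ℝ σ) (x : Fin n → X) (θ : Params m d) :
    HasGradientAt (loss σ fstar x) ((1 / (n : ℝ)) • ∑ i,
      (network σ θ (x i : Input d) - fstar (x i)) • featureVec σ θ (x i : Input d)) θ := by
  have h := ((HasFDerivAt.fun_sum (u := Finset.univ) fun i (_ : i ∈ Finset.univ) =>
    (((hasGradientAt_network hσ θ (x i : Input d)).hasFDerivAt.sub_const (fstar (x i))).pow
      2)).const_mul (1 / (n : ℝ))).const_mul (1 / 2 : ℝ)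
  refine HasFDerivAt.congr_fderiv (f' := _) h ?_
  ext v
  simp only [smul_apply, sum_apply, InnerProductSpace.toDual_apply_apply, smul_eq_mul,
    inner_smul_left, sum_inner, conj_trivial]
  rw [← mul_assoc, mul_comm (1 / 2 : ℝ), mul_assoc]
  congr 1
  rw [Finset.mul_sum]
  refine Finset.sum_congr rfl fun i _ => ?_
  simp
  ring

/-- An average of `r_i v_i` is bounded by the root mean square of the `r_i`. -/
theorem norm_avg_smul_le {V : Type*} [NormedAddCommGroup V] [NormedSpace ℝ V] (r : Fin n → ℝ)
    (v : Fin n → V) {B : ℝ} (hB0 : 0 ≤ B) (hB : ∀ i, ‖v i‖ ≤ B) :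
    ‖(1 / (n : ℝ)) • ∑ i, r i • v i‖ ≤ B * Real.sqrt ((1 / (n : ℝ)) * ∑ i, r i ^ 2) := by
  rcases Nat.eq_zero_or_pos n with rfl | hn
  · simp
  have hn' : (0 : ℝ) < n := by exact_mod_cast hn
  have h1 : ‖∑ i, r i • v i‖ ≤ B * ∑ i, |r i| := by
    refine (norm_sum_le _ _).trans ?_
    rw [Finset.mul_sum]
    refine Finset.sum_le_sum fun i _ => ?_
    rw [norm_smul, mul_comm, Real.norm_eq_abs]
    exact mul_le_mul_of_nonneg_right (hB i) (abs_nonneg _)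
  have h2 : (1 / (n : ℝ)) * ∑ i, |r i| ≤ Real.sqrt ((1 / (n : ℝ)) * ∑ i, r i ^ 2) := by
    refine Real.le_sqrt_of_sq_le ?_
    have h3 := sq_sum_le_card_mul_sum_sq (s := Finset.univ) (f := fun i => |r i|)
    simp only [Finset.card_univ, Fintype.card_fin, sq_abs] at h3
    calc _ = (1 / (n : ℝ)) ^ 2 * (∑ i, |r i|) ^ 2 := mul_pow _ _ _
      _ ≤ (1 / (n : ℝ)) ^ 2 * (n * ∑ i, r i ^ 2) := by gcongr
      _ = _ := by field_simp
  rw [norm_smul, Real.norm_eq_abs, abs_of_pos (by positivity)]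
  calc _ ≤ 1 / (n : ℝ) * (B * ∑ i, |r i|) := by gcongr
    _ = B * (1 / (n : ℝ) * ∑ i, |r i|) := by ring
    _ ≤ _ := by gcongr

/-- Along the flow the loss has derivative -‖∇Φ‖². -/
theorem IsGradientFlow.empResidualSq_le (hσ : Differentiable ℝ σ) {x : Fin n → X}
    {θ₀ : Params m d} {θ : ℝ → Params m d} (h : IsGradientFlow σ fstar x θ₀ θ) {t : ℝ}
    (ht : 0 ≤ t) : empResidualSq σ fstar x (θ t) ≤ empResidualSq σ fstar x θ₀ := by
  have hd : ∀ t, 0 ≤ t → HasDerivWithinAt (fun t => loss σ fstar x (θ t))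
      (-‖gradient (loss σ fstar x) (θ t)‖ ^ 2) (Ici 0) t := by
    intro t ht
    have h1 := (hasGradientAt_loss (fstar := fstar) hσ x (θ t)).differentiableAt.hasGradientAt
    have h2 := h1.hasFDerivAt.comp_hasDerivWithinAt t (h.flow t ht)
    convert! h2 using 1
    rw [InnerProductSpace.toDual_apply_apply, inner_neg_right, real_inner_self_eq_norm_sq]
  have hanti : AntitoneOn (fun t => loss σ fstar x (θ t)) (Ici 0) := by
    refine antitoneOn_of_deriv_nonpos (convex_Ici 0)
      (fun t ht => (hd t ht).continuousWithinAt) ?_ ?_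
    · intro t ht
      rw [interior_Ici] at ht
      exact ((hd t (le_of_lt ht)).hasDerivAt
        (Ici_mem_nhds ht)).differentiableAt.differentiableWithinAt
    · intro t ht
      rw [interior_Ici] at ht
      rw [((hd t (le_of_lt ht)).hasDerivAt (Ici_mem_nhds ht)).deriv]
      exact neg_nonpos.2 (sq_nonneg _)
  have h1 := hanti (mem_Ici.2 le_rfl) (mem_Ici.2 ht) ht
  simp only [loss, h.init] at h1
  linarith

end Loss

/-- From e^y - 1 ≤ y e^y; this form has no division by K. -/
theorem gronwallBound_zero_le {K ε x : ℝ} (hK : 0 ≤ K) (hε : 0 ≤ ε) :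
    gronwallBound 0 K ε x ≤ ε * x * Real.exp (K * x) := by
  rcases hK.eq_or_lt with rfl | hK
  · simp [gronwallBound_K0]
  rw [gronwallBound_of_K_ne_0 hK.ne']
  have h1 : Real.exp (K * x) - 1 ≤ K * x * Real.exp (K * x) := by
    have h2 := Real.add_one_le_exp (-(K * x))
    have h3 : Real.exp (-(K * x)) * Real.exp (K * x) = 1 := by rw [← Real.exp_add]; simp
    nlinarith [Real.exp_pos (K * x)]
  calc 0 * Real.exp (K * x) + ε / K * (Real.exp (K * x) - 1)
      ≤ 0 * Real.exp (K * x) + ε / K * (K * x * Real.exp (K * x)) := by gcongr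
    _ = ε * x * Real.exp (K * x) := by field_simp; ring

/-! ### How far the parameters move -/

section Trajectory

variable {X : Set (Input d)} {σ : ℝ → ℝ} {fstar : X → ℝ} {n : ℕ} {M : ℝ}

theorem norm_gradient_loss_le (hσ : Differentiable ℝ σ) (x : Fin n → X) (θ : Params m d) {B : ℝ}
    (hB0 : 0 ≤ B) (hB : ∀ y : X, ‖featureVec σ θ (y : Input d)‖ ≤ B) :
    ‖gradient (loss σ fstar x) θ‖ ≤ B * Real.sqrt (empResidualSq σ fstar x θ) := by
  rw [(hasGradientAt_loss hσ x θ).gradient]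
  exact norm_avg_smul_le _ _ hB0 fun i => hB (x i)

/-- The speed is at most 2D ξ(θ_s) ‖r̂_0‖, and ξ(θ_s) grows at most linearly in the displacement, so
Grönwall applies. The smallness hypothesis bounds the exponent by 2, and e² ≤ 8 gives 16 = 2 · 8. -/
theorem IsGradientFlow.norm_sub_le (hσ : Differentiable ℝ σ)
    (hσ₁ : ∃ B : ℝ, ∀ z, |deriv σ z| ≤ B) (hm : 0 < m) (hX : ∀ x ∈ X, ‖x‖ ≤ M)
    {x : Fin n → X} {θ₀ : Params m d} {θ : ℝ → Params m d} (h : IsGradientFlow σ fstar x θ₀ θ)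
    {t : ℝ} (ht : 0 ≤ t)
    (hsmall : constD σ M * Real.sqrt (empResidualSq σ fstar x θ₀) * t ≤ Real.sqrt m) :
    ‖θ t - θ₀‖ ≤ 16 * constD σ M * xi θ₀ * Real.sqrt (empResidualSq σ fstar x θ₀) * t := by
  have hD3 := (constD_bounds σ M).1
  have hξ := one_le_xi θ₀
  set D := constD σ M
  set r := Real.sqrt (empResidualSq σ fstar x θ₀) with hr
  have hr0 : 0 ≤ r := Real.sqrt_nonneg _
  have hsq : 0 < Real.sqrt m := Real.sqrt_pos.2 (by exact_mod_cast hm)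
  have hcont : ContinuousOn (fun s => θ s - θ₀) (Icc 0 t) := fun s hs =>
    (((h.flow s hs.1).continuousWithinAt).mono Icc_subset_Ici_self).sub continuousWithinAt_const
  have hderiv : ∀ s ∈ Ico 0 t, HasDerivWithinAt (fun s => θ s - θ₀)
      (-gradient (loss σ fstar x) (θ s)) (Ici s) s := fun s hs =>
    ((h.flow s hs.1).mono (Ici_subset_Ici.2 hs.1)).sub_const θ₀
  have hbound : ∀ s ∈ Ico 0 t, ‖-gradient (loss σ fstar x) (θ s)‖ ≤
      2 * D * r / Real.sqrt m * ‖θ s - θ₀‖ + 2 * D * r * xi θ₀ := by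
    intro s hs
    rw [norm_neg]
    have h1 := norm_gradient_loss_le (fstar := fstar) hσ x (θ s) (B := 2 * D * xi (θ s))
      (by have := one_le_xi (θ s); positivity)
      (fun y => norm_featureVec_le hσ hσ₁ hm (θ s) (hX y y.2))
    have h2 : Real.sqrt (empResidualSq σ fstar x (θ s)) ≤ r :=
      Real.sqrt_le_sqrt (h.empResidualSq_le hσ hs.1)
    have h3 := xi_le_add (θ s) θ₀
    have h4 := one_le_xi (θ s)
    calc _ ≤ 2 * D * xi (θ s) * Real.sqrt (empResidualSq σ fstar x (θ s)) := h1
      _ ≤ 2 * D * (xi θ₀ + ‖θ s - θ₀‖ / Real.sqrt m) * r := by gcongr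
      _ = _ := by ring
  have hg := norm_le_gronwallBound_of_norm_deriv_right_le hcont hderiv
    (δ := 0) (by simp [h.init]) hbound t (right_mem_Icc.2 ht)
  rw [sub_zero] at hg
  have hexp : Real.exp (2 * D * r / Real.sqrt m * t) ≤ 8 := by
    have h1 : 2 * D * r / Real.sqrt m * t ≤ 2 := by
      rw [div_mul_eq_mul_div, div_le_iff₀ hsq]
      linarith
    refine (Real.exp_le_exp.2 h1).trans ?_
    have h2 : Real.exp 2 = Real.exp 1 * Real.exp 1 := by rw [← Real.exp_add]; norm_num
    have h3 := Real.exp_one_lt_d9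
    have h4 := Real.exp_pos 1
    rw [h2]
    nlinarith
  calc ‖θ t - θ₀‖ ≤ _ := hg
    _ ≤ 2 * D * r * xi θ₀ * t * Real.exp (2 * D * r / Real.sqrt m * t) :=
      gronwallBound_zero_le (by positivity) (by positivity)
    _ ≤ 2 * D * r * xi θ₀ * t * 8 := by gcongr
    _ = _ := by ring

/-- Within the ball ξ ≤ (1 + 16) ξ(θ₀), whence 34 = 2 · 17. -/
theorem norm_featureVec_le_of_mem_closedBall (hσ : Differentiable ℝ σ)
    (hσ₁ : ∃ B : ℝ, ∀ z, |deriv σ z| ≤ B) (hm : 0 < m) {θ₀ θ : Params m d} {R : ℝ}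
    (hR : R ≤ 16 * xi θ₀ * Real.sqrt m) (hθ : θ ∈ Metric.closedBall θ₀ R) {x : Input d}
    (hx : ‖x‖ ≤ M) : ‖featureVec σ θ x‖ ≤ 34 * constD σ M * xi θ₀ := by
  have hsq : 0 < Real.sqrt m := Real.sqrt_pos.2 (by exact_mod_cast hm)
  have hD3 := (constD_bounds σ M).1
  rw [Metric.mem_closedBall, dist_eq_norm] at hθ
  have h1 : ‖θ - θ₀‖ / Real.sqrt m ≤ 16 * xi θ₀ := by
    rw [div_le_iff₀ hsq]; exact hθ.trans hR
  have h2 := xi_le_add θ θ₀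
  calc _ ≤ 2 * constD σ M * xi θ := norm_featureVec_le hσ hσ₁ hm θ hx
    _ ≤ 2 * constD σ M * (17 * xi θ₀) := by gcongr; linarith
    _ = _ := by ring

end Trajectory

/-! ### Sampling error of Ψ_0† r, uniformly in θ -/

section Deviation

variable {X : Set (Input d)} [CompactSpace X] (ρ : Measure X) [IsProbabilityMeasure ρ]

/-- The empirical version of `T_{K_0} r` is close to `T_{K_0} r`, uniformly over the residuals `r`
of all parameters in a ball. -/
theorem measure_exists_adjoint_featureOp_sub_avg_le {σ : ℝ → ℝ} (hσ : ContDiff ℝ 2 σ)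
    {fstar : X → ℝ} (hf : MemLp fstar ∞ ρ) (θ₀ : Params m d) {R F Q k : ℝ} (hR : 0 ≤ R)
    (hF0 : 0 ≤ F) (hQ0 : 0 ≤ Q) (hk0 : 0 ≤ k)
    (hF : ∀ᵐ x : X ∂ρ, |network σ θ₀ (x : Input d) - fstar x| ≤ F)
    (hQ : ∀ θ ∈ Metric.closedBall θ₀ R, ∀ x : X, ‖featureVec σ θ (x : Input d)‖ ≤ Q)
    (hk : ∀ x : X, ‖featureVec σ θ₀ (x : Input d)‖ ≤ k)
    {n : ℕ} (hn : 0 < n) {δ : ℝ} (hδ : 0 < δ) (hδ1 : δ < 1) :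
    Measure.pi (fun _ : Fin n => ρ)
      {x | ¬ ∀ θ ∈ Metric.closedBall θ₀ R,
        ‖ContinuousLinearMap.adjoint (featureOp ρ hσ θ₀) (residual ρ hσ hf θ) -
          (1 / (n : ℝ)) • ∑ i, (network σ θ (x i : Input d) - fstar (x i)) •
            featureVec σ θ₀ (x i : Input d)‖ ≤
        6 * (2 * (k * (F + Q * R))) * Real.sqrt (2 * numParams m d) *
          Real.log (Real.exp 1 * n / δ) / Real.sqrt n} ≤ ENNReal.ofReal δ := by
  have hd1 : Differentiable ℝ σ := hσ.differentiable (by norm_num)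
  set A := F + Q * R with hA
  have hA0 : 0 ≤ A := by positivity
  let Θ : Params m d → Params m d := fun e => θ₀ + R • e
  have hΘ : ∀ e, ‖e‖ ≤ 1 → Θ e ∈ Metric.closedBall θ₀ R := by
    intro e he
    rw [Metric.mem_closedBall, dist_eq_norm, add_sub_cancel_left, norm_smul, Real.norm_eq_abs,
      abs_of_nonneg hR]
    nlinarith
  have hnet : ∀ θ ∈ Metric.closedBall θ₀ R, ∀ θ' ∈ Metric.closedBall θ₀ R, ∀ x : X,
      |network σ θ (x : Input d) - network σ θ' (x : Input d)| ≤ Q * ‖θ - θ'‖ :=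
    fun θ hθ θ' hθ' x => abs_network_sub_le hd1 (convex_closedBall θ₀ R)
      (fun η hη => hQ η hη x) hθ' hθ
  have hres : ∀ᵐ x : X ∂ρ, ∀ θ ∈ Metric.closedBall θ₀ R,
      |network σ θ (x : Input d) - fstar x| ≤ A := by
    filter_upwards [hF] with x hx θ hθ
    have h1 := hnet θ hθ θ₀ (Metric.mem_closedBall_self hR) x
    have h2 : ‖θ - θ₀‖ ≤ R := by rwa [← dist_eq_norm]
    calc _ = |(network σ θ (x : Input d) - network σ θ₀ (x : Input d)) +
          (network σ θ₀ (x : Input d) - fstar x)| := by ring_nf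
      _ ≤ _ := abs_add_le _ _
      _ ≤ Q * R + F := add_le_add (h1.trans (by gcongr)) hx
      _ = A := add_comm _ _
  -- The first coordinate is a direction that recovers a norm by duality, the second a parameter of
  -- the rescaled ball. The max norm on the product makes its unit ball the product of the unit
  -- balls.
  let h : Params m d × Params m d → X → ℝ := fun e x =>
    inner ℝ (featureVec σ θ₀ (x : Input d)) e.1 * (network σ (Θ e.2) (x : Input d) - fstar x)
  have hinner : ∀ (u : Params m d) (x : X),
      |inner ℝ (featureVec σ θ₀ (x : Input d)) u| ≤ k * ‖u‖ := fun u x =>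
    (abs_real_inner_le_norm _ _).trans (mul_le_mul_of_nonneg_right (hk x) (norm_nonneg _))
  have hm : ∀ e, ‖e‖ ≤ 1 → AEMeasurable (h e) ρ := by
    intro e _
    have h1 : Continuous fun x : X => inner ℝ (featureVec σ θ₀ (x : Input d)) e.1 :=
      ((continuous_featureVec hσ θ₀).comp continuous_subtype_val).inner continuous_const
    have h2 : Continuous fun x : X => network σ (Θ e.2) (x : Input d) :=
      (continuous_network hσ _).comp continuous_subtype_val
    exact h1.measurable.aemeasurable.mul
      (h2.measurable.aemeasurable.sub hf.1.aemeasurable)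
  have hbd : ∀ᵐ x ∂ρ, ∀ e, ‖e‖ ≤ 1 → |h e x| ≤ 2 * (k * A) := by
    filter_upwards [hres] with x hx e he
    have h1 : ‖e.1‖ ≤ 1 := (norm_fst_le e).trans he
    have h2 : ‖e.2‖ ≤ 1 := (norm_snd_le e).trans he
    have h3 := hx _ (hΘ e.2 h2)
    have h4 : |inner ℝ (featureVec σ θ₀ (x : Input d)) e.1| ≤ k := by
      refine (hinner e.1 x).trans ?_
      nlinarith
    calc |h e x| = |inner ℝ (featureVec σ θ₀ (x : Input d)) e.1| *
          |network σ (Θ e.2) (x : Input d) - fstar x| := abs_mul _ _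
      _ ≤ k * A := by gcongr
      _ ≤ 2 * (k * A) := by nlinarith [mul_nonneg hk0 hA0]
  have hlip : ∀ᵐ x ∂ρ, ∀ e, ‖e‖ ≤ 1 → ∀ e', ‖e'‖ ≤ 1 →
      |h e x - h e' x| ≤ 2 * (k * A) * ‖e - e'‖ := by
    filter_upwards [hres] with x hx e he e' he'
    have h2 : ‖e.2‖ ≤ 1 := (norm_snd_le e).trans he
    have h1' : ‖e'.1‖ ≤ 1 := (norm_fst_le e').trans he'
    have h2' : ‖e'.2‖ ≤ 1 := (norm_snd_le e').trans he'
    have h3 := hx _ (hΘ e.2 h2)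
    have hf1 : ‖e.1 - e'.1‖ ≤ ‖e - e'‖ := norm_fst_le (e - e')
    have hf2 : ‖e.2 - e'.2‖ ≤ ‖e - e'‖ := norm_snd_le (e - e')
    have h5 : |network σ (Θ e.2) (x : Input d) - network σ (Θ e'.2) (x : Input d)| ≤
        A * ‖e - e'‖ := by
      refine (hnet _ (hΘ _ h2) _ (hΘ _ h2') x).trans ?_
      have : Θ e.2 - Θ e'.2 = R • (e.2 - e'.2) := by
        simp only [Θ]; rw [smul_sub]; abel
      rw [this, norm_smul, Real.norm_eq_abs, abs_of_nonneg hR, ← mul_assoc]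
      gcongr
      linarith
    have h6 : |inner ℝ (featureVec σ θ₀ (x : Input d)) e'.1| ≤ k := by
      refine (hinner e'.1 x).trans ?_
      nlinarith
    have h7 : |inner ℝ (featureVec σ θ₀ (x : Input d)) (e.1 - e'.1)| ≤ k * ‖e - e'‖ :=
      (hinner _ x).trans (by gcongr)
    have h8 : h e x - h e' x = inner ℝ (featureVec σ θ₀ (x : Input d)) (e.1 - e'.1) *
          (network σ (Θ e.2) (x : Input d) - fstar x) +
        inner ℝ (featureVec σ θ₀ (x : Input d)) e'.1 *
          (network σ (Θ e.2) (x : Input d) - network σ (Θ e'.2) (x : Input d)) := by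
      simp only [h, inner_sub_right]; ring
    rw [h8]
    refine (abs_add_le _ _).trans ?_
    rw [abs_mul, abs_mul]
    calc _ ≤ k * ‖e - e'‖ * A + k * (A * ‖e - e'‖) := by gcongr
      _ = _ := by ring
  have hrank : Module.finrank ℝ (Params m d × Params m d) = 2 * numParams m d := by
    rw [Module.finrank_prod, finrank_euclideanSpace, card_paramIndex]; ring
  have hmain := measure_exists_deviation_le ρ hn h (b := 2 * (k * A)) (by positivity) hm hbd hlip
    (by rw [hrank, numParams]; omega) hδ hδ1
  refine (measure_mono ?_).trans hmain
  rw [hrank]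
  intro x hx hgood
  apply hx
  intro θ hθ
  -- For R = 0 the convention 0⁻¹ = 0 gives e₂ = 0, which is right because then θ = θ₀.
  set e₂ : Params m d := R⁻¹ • (θ - θ₀) with he₂
  have hθR : ‖θ - θ₀‖ ≤ R := by rwa [← dist_eq_norm]
  have he₂1 : ‖e₂‖ ≤ 1 := by
    rw [he₂, norm_smul, norm_inv, Real.norm_eq_abs, abs_of_nonneg hR]
    exact inv_mul_le_one_of_le₀ hθR hR
  have hΘe : Θ e₂ = θ := by
    simp only [Θ, he₂]
    rcases hR.eq_or_lt with h0 | h0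
    · have : θ - θ₀ = 0 := norm_le_zero_iff.1 (by rw [h0]; exact hθR)
      rw [this, smul_zero, smul_zero, add_zero, sub_eq_zero.1 this]
    · rw [smul_inv_smul₀ h0.ne']; abel
  set z := ContinuousLinearMap.adjoint (featureOp ρ hσ θ₀) (residual ρ hσ hf θ) -
          (1 / (n : ℝ)) • ∑ i, (network σ θ (x i : Input d) - fstar (x i)) •
            featureVec σ θ₀ (x i : Input d) with hz
  have hzu : ∀ u : Params m d, inner ℝ u z =
      ∫ y, h (u, e₂) y ∂ρ - (1 / (n : ℝ)) * ∑ i, h (u, e₂) (x i) := by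
    intro u
    rw [hz, inner_sub_right, inner_adjoint_featureOp_residual, real_inner_smul_right, inner_sum]
    simp only [h, hΘe]
    congr 2
    refine Finset.sum_congr rfl fun i _ => ?_
    rw [real_inner_smul_right, real_inner_comm, mul_comm]
  have hu : ‖(‖z‖⁻¹ • z, e₂)‖ ≤ 1 := by
    refine max_le ?_ he₂1
    rw [norm_smul, norm_inv, norm_norm]
    exact inv_mul_le_one_of_le₀ le_rfl (norm_nonneg _)
  have hfin := hgood _ hu
  rw [abs_sub_comm, ← hzu, real_inner_smul_left, real_inner_self_eq_norm_sq] at hfin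
  have hzz : ‖z‖⁻¹ * ‖z‖ ^ 2 = ‖z‖ := by
    rcases eq_or_ne ‖z‖ 0 with h0 | h0
    · rw [h0]; simp
    · field_simp
  rw [hzz, abs_of_nonneg (norm_nonneg _)] at hfin
  exact_mod_cast hfin

end Deviation

/-! ### The feature drift and the reduction to the forcing term -/

section Forcing

variable {X : Set (Input d)} [CompactSpace X] (ρ : Measure X) [IsProbabilityMeasure ρ]

/-- The difference of the kernel operators at `θ₀` and `θ`, applied to the sampled residual. -/
theorem norm_featureOp_avg_sub_le {σ : ℝ → ℝ} (hσ : ContDiff ℝ 2 σ) {fstar : X → ℝ} {n : ℕ}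
    (x : Fin n → X) (θ₀ θ : Params m d) {η B₀ B : ℝ} (hη0 : 0 ≤ η) (hB₀0 : 0 ≤ B₀) (hB0 : 0 ≤ B)
    (hη : ∀ y : X, ‖featureVec σ θ₀ (y : Input d) - featureVec σ θ (y : Input d)‖ ≤ η)
    (hB₀ : ∀ y : X, ‖featureVec σ θ₀ (y : Input d)‖ ≤ B₀)
    (hB : ∀ y : X, ‖featureVec σ θ (y : Input d)‖ ≤ B) :
    ‖featureOp ρ hσ θ₀ ((1 / (n : ℝ)) • ∑ i, (network σ θ (x i : Input d) - fstar (x i)) •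
        featureVec σ θ₀ (x i : Input d)) - featureOp ρ hσ θ (gradient (loss σ fstar x) θ)‖ ≤
      η * (B₀ + B) * Real.sqrt (empResidualSq σ fstar x θ) := by
  rw [(hasGradientAt_loss (hσ.differentiable (by norm_num)) x θ).gradient]
  set r : Fin n → ℝ := fun i => network σ θ (x i : Input d) - fstar (x i)
  set v₀ := (1 / (n : ℝ)) • ∑ i, r i • featureVec σ θ₀ (x i : Input d) with hv₀
  set v := (1 / (n : ℝ)) • ∑ i, r i • featureVec σ θ (x i : Input d) with hv
  change ‖featureOp ρ hσ θ₀ v₀ - featureOp ρ hσ θ v‖ ≤ _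
  set q := Real.sqrt (empResidualSq σ fstar x θ) with hq
  have h1 : ‖v₀‖ ≤ B₀ * q := norm_avg_smul_le _ _ hB₀0 fun i => hB₀ (x i)
  have h2 : ‖v₀ - v‖ ≤ η * q := by
    rw [hv₀, hv, ← smul_sub, ← Finset.sum_sub_distrib]
    simp only [← smul_sub]
    exact norm_avg_smul_le _ _ hη0 fun i => hη (x i)
  have h3 := norm_featureOp_apply_sub_le ρ hσ θ₀ θ v₀ hη0 hη
  have h4 := norm_featureOp_apply_le ρ hσ θ (v₀ - v) hB0 hB
  -- Change the features in the outer operator first, then those inside the average.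
  have h5 : featureOp ρ hσ θ₀ v₀ - featureOp ρ hσ θ v =
      (featureOp ρ hσ θ₀ v₀ - featureOp ρ hσ θ v₀) + featureOp ρ hσ θ (v₀ - v) := by
    rw [map_sub]; abel
  rw [h5]
  calc _ ≤ η * ‖v₀‖ + B * ‖v₀ - v‖ := (norm_add_le _ _).trans (add_le_add h3 h4)
    _ ≤ η * (B₀ * q) + B * (η * q) := by gcongr
    _ = _ := by ring

theorem isSelfAdjoint_ntkOperator {σ : ℝ → ℝ} (hσ : ContDiff ℝ 2 σ) (θ : Params m d) :
    IsSelfAdjoint (ntkOperator ρ hσ θ) := by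
  rw [ntkOperator_eq, ContinuousLinearMap.isSelfAdjoint_iff_isSymmetric]
  intro f g
  change inner ℝ (featureOp ρ hσ θ (ContinuousLinearMap.adjoint (featureOp ρ hσ θ) f)) g =
    inner ℝ f (featureOp ρ hσ θ (ContinuousLinearMap.adjoint (featureOp ρ hσ θ) g))
  rw [← ContinuousLinearMap.adjoint_inner_right, ContinuousLinearMap.adjoint_inner_left]

theorem inner_ntkOperator_nonneg {σ : ℝ → ℝ} (hσ : ContDiff ℝ 2 σ) (θ : Params m d)
    (f : Lp ℝ 2 ρ) : 0 ≤ inner ℝ (ntkOperator ρ hσ θ f) f := by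
  rw [ntkOperator_eq]
  change 0 ≤ inner ℝ (featureOp ρ hσ θ (ContinuousLinearMap.adjoint (featureOp ρ hσ θ) f)) f
  rw [← ContinuousLinearMap.adjoint_inner_right]
  exact real_inner_self_nonneg

/-- A bound on the forcing term `T_{K_0} r_s + ∂_s r_s` controls the deviation of the residual from
the linearized dynamics. -/
theorem IsGradientFlow.residual_sub_exp_le {σ : ℝ → ℝ} (hσ : ContDiff ℝ 2 σ)
    (hσ₁ : ∃ B : ℝ, ∀ z, |deriv σ z| ≤ B) (hσ₂ : ∃ B : ℝ, ∀ z, |deriv (deriv σ) z| ≤ B)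
    {M : ℝ} (hX : ∀ x ∈ X, ‖x‖ ≤ M) {fstar : X → ℝ} (hf : MemLp fstar ∞ ρ) {n : ℕ}
    {x : Fin n → X} {θ₀ : Params m d} {θ : ℝ → Params m d} (h : IsGradientFlow σ fstar x θ₀ θ)
    {N : ℕ} {s : Fin N → ℝ} {φ : Fin N → Lp ℝ 2 ρ}
    (hφ : IsEigenEnumeration (ntkOperator ρ hσ θ₀) s φ) {t E : ℝ} (ht : 0 ≤ t)
    (hE : ∀ u ∈ Ico 0 t, ‖ntkOperator ρ hσ θ₀ (residual ρ hσ hf (θ u)) -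
      featureOp ρ hσ (θ u) (gradient (loss σ fstar x) (θ u))‖ ≤ E) :
    (∀ k : Fin N, ‖topProjection φ k (residual ρ hσ hf (θ t)
        - NormedSpace.exp (-(t • ntkOperator ρ hσ θ₀)) (residual ρ hσ hf θ₀))‖
          ≤ (1 - Real.exp (-(s k * t))) / s k * E) ∧
      ‖residual ρ hσ hf (θ t)
        - NormedSpace.exp (-(t • ntkOperator ρ hσ θ₀)) (residual ρ hσ hf θ₀)‖ ≤ t * E := by
  have hd : ∀ u, 0 ≤ u → HasDerivWithinAt (fun u => residual ρ hσ hf (θ u))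
      (-featureOp ρ hσ (θ u) (gradient (loss σ fstar x) (θ u))) (Ici 0) u := by
    intro u hu
    have h1 := (hasFDerivAt_residual ρ hσ hσ₁ hσ₂ hX hf (θ u)).comp_hasDerivWithinAt u (h.flow u hu)
    rwa [map_neg] at h1
  have hcont : ContinuousOn (fun u => residual ρ hσ hf (θ u)) (Icc 0 t) := fun u hu =>
    (hd u hu.1).continuousWithinAt.mono Icc_subset_Ici_self
  set A := ntkOperator ρ hσ θ₀ with hA
  set g : ℝ → Lp ℝ 2 ρ := fun u => A (residual ρ hσ hf (θ u)) -
      featureOp ρ hσ (θ u) (gradient (loss σ fstar x) (θ u)) with hg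
  have hd' : ∀ u ∈ Ico 0 t, HasDerivWithinAt (fun u => residual ρ hσ hf (θ u))
      (g u - A (residual ρ hσ hf (θ u))) (Ici u) u := by
    intro u hu
    have h1 : g u - A (residual ρ hσ hf (θ u)) =
        -featureOp ρ hσ (θ u) (gradient (loss σ fstar x) (θ u)) := by
      simp only [hg]; abel
    rw [h1]
    exact (hd u hu.1).mono (Ici_subset_Ici.2 hu.1)
  constructor
  · intro k
    have hs := hφ.ne_zero k
    -- The primitive of e^{-s_k(t-u)} E that vanishes at u = 0; at u = t it is the claimed bound.
    have hB : ∀ u, HasDerivAt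
        (fun u => (Real.exp (-(s k * (t - u))) - Real.exp (-(s k * t))) / s k * E)
        (Real.exp (-(s k * (t - u))) * E) u := by
      intro u
      have h1 : HasDerivAt (fun u => -(s k * (t - u))) (s k) u := by
        simpa using (((hasDerivAt_id u).const_sub t).const_mul (s k)).fun_neg
      have h2 := ((h1.exp.sub_const (Real.exp (-(s k * t)))).div_const (s k)).mul_const E
      convert! h2 using 1
      field_simp
    have := norm_apply_sub_exp_apply_le (A := A) (P := topProjection φ k) ht hcont hd'
      (by simp) hB (fun u hu =>
        (norm_topProjection_exp_le (isSelfAdjoint_ntkOperator ρ hσ θ₀) hφ k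
          (sub_nonneg.2 hu.2.le) (g u)).trans
          (mul_le_mul_of_nonneg_left (hE u hu) (Real.exp_pos _).le))
    simpa [h.init] using this
  · have hB : ∀ u, HasDerivAt (fun u => u * E) E u := fun u => by
      simpa using (hasDerivAt_id u).mul_const E
    have := norm_apply_sub_exp_apply_le (A := A) (P := ContinuousLinearMap.id ℝ _) ht hcont hd'
      (by simp) hB (fun u hu => (norm_exp_neg_smul_apply_le (inner_ntkOperator_nonneg ρ hσ θ₀)
          (sub_nonneg.2 hu.2.le) (g u)).trans (hE u hu))
    simpa [h.init] using this

end Forcing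

/-- The constant of the main theorem. -/
noncomputable def constantC (σ : ℝ → ℝ) (M : ℝ) : ℝ :=
  constD σ M ^ 2 * (13056 + 1088 * gradLip σ M)

theorem constantC_pos (σ : ℝ → ℝ) (M : ℝ) : 0 < constantC σ M := by
  have h1 := (constD_bounds σ M).1
  have h2 := gradLip_nonneg σ M
  have h3 : 0 < constD σ M := by linarith
  rw [constantC]
  positivity

theorem le_constantC (σ : ℝ → ℝ) (M : ℝ) :
    13056 * constD σ M ^ 2 ≤ constantC σ M ∧
      1088 * constD σ M ^ 2 * gradLip σ M ≤ constantC σ M := by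
  have h1 : 0 ≤ constD σ M ^ 2 * gradLip σ M := mul_nonneg (sq_nonneg _) (gradLip_nonneg σ M)
  have h2 := sq_nonneg (constD σ M)
  have h3 : constantC σ M = 13056 * constD σ M ^ 2 + 1088 * (constD σ M ^ 2 * gradLip σ M) := by
    rw [constantC]; ring
  constructor <;> rw [h3] <;> linarith

theorem iSup_ntk_nonneg {X : Set (Input d)} {σ : ℝ → ℝ} (hσ : ContDiff ℝ 2 σ) (θ : Params m d) :
    0 ≤ ⨆ x : X, ntk σ θ (x : Input d) (x : Input d) :=
  Real.iSup_nonneg fun y => by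
    rw [ntk_eq_inner (hσ.differentiable (by norm_num))]; exact real_inner_self_nonneg

theorem ae_abs_network_sub_le_lpNorm {X : Set (Input d)}
    [CompactSpace X] (ρ : Measure X) {σ : ℝ → ℝ} (hσ : ContDiff ℝ 2 σ) {fstar : X → ℝ}
    (hf : MemLp fstar ∞ ρ) (θ : Params m d) :
    ∀ᵐ x : X ∂ρ, |network σ θ (x : Input d) - fstar x| ≤
      lpNorm fstar ∞ ρ + lpNorm (fun x : X => network σ θ (x : Input d)) ∞ ρ := by
  have hcont : Continuous fun x : X => network σ θ (x : Input d) :=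
    (continuous_network hσ θ).comp continuous_subtype_val
  have hmem : MemLp (fun x : X => network σ θ (x : Input d)) ∞ ρ := by
    obtain ⟨B, hB⟩ := isCompact_univ.exists_bound_of_continuousOn hcont.continuousOn
    exact memLp_top_of_bound hcont.aestronglyMeasurable B
      (Filter.Eventually.of_forall fun x => hB x (mem_univ _))
  filter_upwards [ae_le_lpNorm_exponent_top hf, ae_le_lpNorm_exponent_top hmem] with x h1 h2
  rw [Real.norm_eq_abs] at h1 h2
  linarith [abs_sub (network σ θ (x : Input d)) (fstar x)]

/-! ### The complete bound on the forcing term -/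

section Final

variable {X : Set (Input d)} [CompactSpace X] (ρ : Measure X) [IsProbabilityMeasure ρ]

theorem norm_featureVec_le_sqrt_iSup_ntk {σ : ℝ → ℝ} (hσ : ContDiff ℝ 2 σ) (θ : Params m d)
    (x : X) : ‖featureVec σ θ (x : Input d)‖ ≤
      Real.sqrt (⨆ x : X, ntk σ θ (x : Input d) (x : Input d)) := by
  have hbdd : BddAbove (range fun x : X => ntk σ θ (x : Input d) (x : Input d)) := by
    have hc := (continuous_featureVec hσ θ).comp (continuous_subtype_val (p := (· ∈ X)))
    simp only [ntk_eq_inner (hσ.differentiable (by norm_num))]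
    exact (isCompact_range (hc.inner hc)).bddAbove
  refine Real.le_sqrt_of_sq_le ?_
  rw [← real_inner_self_eq_norm_sq, ← ntk_eq_inner (hσ.differentiable (by norm_num))]
  exact le_ciSup hbdd x

/-- The forcing term along a trajectory, on the event that the empirical kernel operator is
uniformly close to `T_{K_0}`. -/
theorem IsGradientFlow.norm_forcing_le {σ : ℝ → ℝ} (hσ : ContDiff ℝ 2 σ)
    (hσ₁ : ∃ B : ℝ, ∀ z, |deriv σ z| ≤ B) (hσ₂ : ∃ B : ℝ, ∀ z, |deriv (deriv σ) z| ≤ B)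
    {M : ℝ} (hX : ∀ x ∈ X, ‖x‖ ≤ M) {fstar : X → ℝ} (hf : MemLp fstar ∞ ρ) {n : ℕ} (hm : 0 < m)
    {x : Fin n → X} {θ₀ : Params m d} {θ : ℝ → Params m d} (hθ : IsGradientFlow σ fstar x θ₀ θ)
    {N : ℕ} {s : Fin N → ℝ} {φ : Fin N → Lp ℝ 2 ρ}
    (hφ : IsEigenEnumeration (ntkOperator ρ hσ θ₀) s φ) {T F S κ L ℓ u t : ℝ} (hF0 : 0 ≤ F)
    (hT : 0 < T) (hκ0 : 0 ≤ κ) (hS : S = F * (1 + T * xi θ₀ ^ 2)) (hL1 : 1 ≤ L) (hℓ0 : 0 ≤ ℓ) (hLle : ℓ ≤ L)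
    (hDFT : constD σ M * F * T ≤ Real.sqrt m)
    (hrF : Real.sqrt (empResidualSq σ fstar x θ₀) ≤ F)
    (hgood : ∀ θ ∈ Metric.closedBall θ₀ (16 * constD σ M * F * T * xi θ₀),
        ‖ContinuousLinearMap.adjoint (featureOp ρ hσ θ₀) (residual ρ hσ hf θ) -
          (1 / (n : ℝ)) • ∑ i, (network σ θ (x i : Input d) - fstar (x i)) •
            featureVec σ θ₀ (x i : Input d)‖ ≤
        6 * (2 * (Real.sqrt κ * (F + 34 * constD σ M * xi θ₀ *
          (16 * constD σ M * F * T * xi θ₀)))) * Real.sqrt (2 * numParams m d) *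
            ℓ / Real.sqrt n)
    (hu : u ∈ Ico 0 t) (htT : t ≤ T) :
    ‖ntkOperator ρ hσ θ₀ (residual ρ hσ hf (θ u)) -
      featureOp ρ hσ (θ u) (gradient (loss σ fstar x) (θ u))‖ ≤
      constantC σ M * L * (t / Real.sqrt m * xi θ₀ ^ 2 * xiTilde θ₀ * empResidualSq σ fstar x θ₀
        + S * Real.sqrt ((⨆ i, s i) * κ * numParams m d) / Real.sqrt n) := by
  have hd1 : Differentiable ℝ σ := hσ.differentiable (by norm_num)
  have hD3 := (constD_bounds σ M).1
  have hΛ := gradLip_nonneg σ M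
  have hsqm : 0 < Real.sqrt m := Real.sqrt_pos.2 (by exact_mod_cast hm)
  have hξ := one_le_xi θ₀
  have hξt := one_le_xiTilde θ₀
  set D := constD σ M with hD
  set ξ := xi θ₀ with hξdef
  set σ₁ := ⨆ i, s i with hσ₁'
  have ht : 0 ≤ t := hu.1.trans hu.2.le
  have hS0 : 0 ≤ S := by rw [hS]; positivity
  set R := 16 * D * F * T * ξ with hR
  have hR0 : 0 ≤ R := by positivity
  have hRm : R ≤ 16 * ξ * Real.sqrt m := by
    calc R = 16 * ξ * (D * F * T) := by rw [hR]; ring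
      _ ≤ _ := by gcongr
  have hQ : ∀ θ ∈ Metric.closedBall θ₀ R, ∀ x : X,
      ‖featureVec σ θ (x : Input d)‖ ≤ 34 * D * ξ := fun θ hθ x =>
    norm_featureVec_le_of_mem_closedBall hd1 hσ₁ hm hRm hθ (hX x x.2)
  set r := Real.sqrt (empResidualSq σ fstar x θ₀) with hr
  have hr0 : 0 ≤ r := Real.sqrt_nonneg _
  have hrsq : r ^ 2 = empResidualSq σ fstar x θ₀ := Real.sq_sqrt (empResidualSq_nonneg x θ₀)
  have huT : u ≤ T := hu.2.le.trans htT
  have hmove : ‖θ u - θ₀‖ ≤ 16 * D * ξ * r * u := by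
    refine hθ.norm_sub_le hd1 hσ₁ hm hX hu.1 (le_trans ?_ hDFT)
    have := hu.1
    gcongr
  have hball : θ u ∈ Metric.closedBall θ₀ R := by
    rw [Metric.mem_closedBall, dist_eq_norm]
    refine hmove.trans ?_
    calc 16 * D * ξ * r * u ≤ 16 * D * ξ * F * T := by
          have := hu.1
          gcongr
      _ = R := by rw [hR]; ring
  have hdiff : ∀ y : X, ‖featureVec σ θ₀ (y : Input d) - featureVec σ (θ u) (y : Input d)‖ ≤
      gradLip σ M * xiTilde θ₀ / Real.sqrt m * (16 * D * ξ * r * t) := by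
    intro y
    rw [norm_sub_rev]
    refine (norm_featureVec_sub_le hσ hσ₁ hσ₂ hξt (θ u) θ₀
      (abs_outerWeights_le_xiTilde θ₀) (hX y y.2)).trans ?_
    gcongr
    refine hmove.trans ?_
    gcongr
    exact hu.2.le
  have h1 := norm_featureOp_avg_sub_le (fstar := fstar) ρ hσ x θ₀ (θ u) (by positivity)
    (by positivity : 0 ≤ 34 * D * ξ) (by positivity : 0 ≤ 34 * D * ξ) hdiff
    (hQ θ₀ (Metric.mem_closedBall_self hR0)) (hQ _ hball)
  have h2 := hgood _ hball
  set avg := (1 / (n : ℝ)) • ∑ i, (network σ (θ u) (x i : Input d) - fstar (x i)) •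
          featureVec σ θ₀ (x i : Input d) with havg
  set Ψ := featureOp ρ hσ θ₀ with hΨ
  have hφ' : IsEigenEnumeration (Ψ ∘L ContinuousLinearMap.adjoint Ψ) s φ := by
    rw [hΨ, ← ntkOperator_eq]; exact hφ
  have h3 := hφ'.norm_apply_le Ψ
    (ContinuousLinearMap.adjoint Ψ (residual ρ hσ hf (θ u)) - avg)
  rw [← hσ₁'] at h3
  have hsplit : ntkOperator ρ hσ θ₀ (residual ρ hσ hf (θ u)) -
      featureOp ρ hσ (θ u) (gradient (loss σ fstar x) (θ u)) =
      (Ψ avg - featureOp ρ hσ (θ u) (gradient (loss σ fstar x) (θ u))) +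
        Ψ (ContinuousLinearMap.adjoint Ψ (residual ρ hσ hf (θ u)) - avg) := by
    rw [ntkOperator_eq, map_sub, ← hΨ, ContinuousLinearMap.comp_apply]
    abel
  have hru : Real.sqrt (empResidualSq σ fstar x (θ u)) ≤ r :=
    Real.sqrt_le_sqrt (hθ.empResidualSq_le hd1 hu.1)
  have h4 : ‖Ψ avg - featureOp ρ hσ (θ u) (gradient (loss σ fstar x) (θ u))‖ ≤
      constantC σ M * L * (t / Real.sqrt m * ξ ^ 2 * xiTilde θ₀ *
        empResidualSq σ fstar x θ₀) := by
    rw [← hrsq]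
    have hbase : 0 ≤ t / Real.sqrt m * ξ ^ 2 * xiTilde θ₀ * r ^ 2 := by positivity
    calc _ ≤ gradLip σ M * xiTilde θ₀ / Real.sqrt m * (16 * D * ξ * r * t) *
          (34 * D * ξ + 34 * D * ξ) * Real.sqrt (empResidualSq σ fstar x (θ u)) := h1
      _ ≤ gradLip σ M * xiTilde θ₀ / Real.sqrt m * (16 * D * ξ * r * t) *
          (34 * D * ξ + 34 * D * ξ) * r := by gcongr
      _ = 1088 * D ^ 2 * gradLip σ M * 1 * (t / Real.sqrt m * ξ ^ 2 * xiTilde θ₀ * r ^ 2) := by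
        ring
      _ ≤ constantC σ M * L * (t / Real.sqrt m * ξ ^ 2 * xiTilde θ₀ * r ^ 2) := by
        have h5 : 1088 * D ^ 2 * gradLip σ M ≤ constantC σ M := (le_constantC σ M).2
        have h6 := (constantC_pos σ M).le
        gcongr
  have h7 : ‖Ψ (ContinuousLinearMap.adjoint Ψ (residual ρ hσ hf (θ u)) - avg)‖ ≤
      constantC σ M * L * (S * Real.sqrt (σ₁ * κ * numParams m d) / Real.sqrt n) := by
    -- 544 = 34 · 16 comes from R; enlarging F by the same factor produces S. Below, 13056 = 6 · 2 ·
    -- 544 · 2.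
    have hA : F + 34 * D * ξ * R ≤ 544 * D ^ 2 * S := by
      have h8 : F ≤ 544 * D ^ 2 * F := le_mul_of_one_le_left hF0 (by nlinarith)
      calc F + 34 * D * ξ * R ≤ 544 * D ^ 2 * F + 34 * D * ξ * R := by linarith
        _ = 544 * D ^ 2 * S := by rw [hR, hS]; ring
    have h9 : Real.sqrt (2 * numParams m d) ≤ 2 * Real.sqrt (numParams m d) := by
      refine Real.sqrt_le_iff.2 ⟨by positivity, ?_⟩
      rw [mul_pow, Real.sq_sqrt (by positivity)]
      linarith
    have hsqrt : Real.sqrt (σ₁ * κ * numParams m d) =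
        Real.sqrt σ₁ * Real.sqrt κ * Real.sqrt (numParams m d) := by
      rw [Real.sqrt_mul' _ (by positivity), Real.sqrt_mul' _ hκ0]
    rw [hsqrt]
    calc _ ≤ Real.sqrt σ₁ * _ := h3
      _ ≤ Real.sqrt σ₁ * (6 * (2 * (Real.sqrt κ * (F + 34 * D * ξ * R))) *
          Real.sqrt (2 * numParams m d) * ℓ / Real.sqrt n) := by
        gcongr
      _ ≤ Real.sqrt σ₁ * (6 * (2 * (Real.sqrt κ * (544 * D ^ 2 * S))) *
          (2 * Real.sqrt (numParams m d)) * L / Real.sqrt n) := by gcongr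
      _ = 13056 * D ^ 2 * L * (S * (Real.sqrt σ₁ * Real.sqrt κ * Real.sqrt (numParams m d)) /
            Real.sqrt n) := by ring
      _ ≤ _ := by
        have h5 : 13056 * D ^ 2 ≤ constantC σ M := (le_constantC σ M).1
        gcongr
  rw [hsplit, mul_add]
  exact (norm_add_le _ _).trans (add_le_add h4 h7)

end Final

end ShallowNTK

/-! ### Assembly on the good event -/

theorem mainTheorem8
    (σ : ℝ → ℝ) (hσ : ContDiff ℝ 2 σ)
    (hσ₁ : ∃ B : ℝ, ∀ z, |deriv σ z| ≤ B)
    (hσ₂ : ∃ B : ℝ, ∀ z, |deriv (deriv σ) z| ≤ B)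
    (M : ℝ) :
    -- the constant in the bound depends on the activation function and on `M` only
    ∃ C : ℝ, 0 < C ∧
      ∀ (d m n : ℕ), 0 < m → 0 < n →
      ∀ (X : Set (Input d)) [CompactSpace X], (∀ x ∈ X, ‖x‖ ≤ M) →
      ∀ (ρ : Measure X) [IsProbabilityMeasure ρ] [ρ.IsOpenPosMeasure]
        (fstar : X → ℝ) (hf : MemLp fstar ∞ ρ)
        (θ₀ : Params m d)
        (N : ℕ) (s : Fin N → ℝ) (φ : Fin N → Lp ℝ 2 ρ),
        IsEigenEnumeration (ntkOperator ρ hσ θ₀) s φ →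
      ∀ (T δ : ℝ), 0 < T → 0 < δ → δ < 1 →
      ∀ (F κ σ₁ S L : ℝ),
        F = lpNorm fstar ∞ ρ + lpNorm (fun x : X => network σ θ₀ (x : Input d)) ∞ ρ →
        κ = (⨆ x : X, ntk σ θ₀ (x : Input d) (x : Input d)) →
        σ₁ = (⨆ i, s i) →
        S = F * (1 + T * xi θ₀ ^ 2) →
        L = Real.log (Real.exp 1 * n * numParams m d * xi θ₀ / δ) →
        constD σ M ^ 2 * F ^ 2 * T ^ 2 ≤ m →
        -- the samples for which one of the two bounds fails at some time have measure at most `δ`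
        Measure.pi (fun _ : Fin n => ρ)
          {x | ¬ ∀ θ : ℝ → Params m d, IsGradientFlow σ fstar x θ₀ θ →
            ∀ t : ℝ, 0 ≤ t → t ≤ T →
              (∀ k : Fin N,
                ‖topProjection φ k (residual ρ hσ hf (θ t)
                    - NormedSpace.exp (-(t • ntkOperator ρ hσ θ₀)) (residual ρ hσ hf θ₀))‖
                  ≤ (1 - Real.exp (-(s k * t))) / s k *
                    (C * L * (t / Real.sqrt m * xi θ₀ ^ 2 * xiTilde θ₀
                        * empResidualSq σ fstar x θ₀
                      + S * Real.sqrt (σ₁ * κ * numParams m d) / Real.sqrt n))) ∧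
              ‖residual ρ hσ hf (θ t)
                  - NormedSpace.exp (-(t • ntkOperator ρ hσ θ₀)) (residual ρ hσ hf θ₀)‖
                ≤ t * (C * L * (t / Real.sqrt m * xi θ₀ ^ 2 * xiTilde θ₀
                      * empResidualSq σ fstar x θ₀
                    + S * Real.sqrt (σ₁ * κ * numParams m d) / Real.sqrt n))}
          ≤ ENNReal.ofReal δ := by
  have hd1 : Differentiable ℝ σ := hσ.differentiable (by norm_num)
  have hD3 := (constD_bounds σ M).1
  refine ⟨constantC σ M, constantC_pos σ M, ?_⟩
  intro d m n hm hn X _ hX ρ _ _ fstar hf θ₀ N s φ hφ T δ hT hδ hδ1 F κ σ₁ S L hF hκ hσ₁' hS hL hmT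
  have hm' : (0 : ℝ) < m := by exact_mod_cast hm
  have hn' : (0 : ℝ) < n := by exact_mod_cast hn
  have hξ := one_le_xi θ₀
  set D := constD σ M with hD
  set ξ := xi θ₀ with hξdef
  have hp1 : (1 : ℝ) ≤ numParams m d := by
    have : 1 ≤ numParams m d := by rw [numParams]; omega
    exact_mod_cast this
  have hres₀ := ae_abs_network_sub_le_lpNorm ρ hσ hf θ₀
  rw [← hF] at hres₀
  have hF0 : 0 ≤ F := by
    rw [hF]
    exact add_nonneg lpNorm_nonneg lpNorm_nonneg
  have hDFT : D * F * T ≤ Real.sqrt m := by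
    refine Real.le_sqrt_of_sq_le ?_
    calc _ = D ^ 2 * F ^ 2 * T ^ 2 := by ring
      _ ≤ m := hmT
  have hκx := norm_featureVec_le_sqrt_iSup_ntk (X := X) hσ θ₀
  have hκ0 := iSup_ntk_nonneg (X := X) hσ θ₀
  rw [← hκ] at hκx hκ0
  -- the logarithmic factor
  have hLle : Real.log (Real.exp 1 * n / δ) ≤ L := by
    rw [hL]
    refine Real.log_le_log (by positivity) ?_
    refine div_le_div_of_nonneg_right ?_ hδ.le
    have : 1 ≤ (numParams m d : ℝ) * ξ := by nlinarith
    calc Real.exp 1 * n = Real.exp 1 * n * 1 := (mul_one _).symm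
      _ ≤ Real.exp 1 * n * (numParams m d * ξ) := by gcongr
      _ = _ := by ring
  have hlog1 : 1 ≤ Real.log (Real.exp 1 * n / δ) := by
    have hn1 : (1 : ℝ) ≤ n := by exact_mod_cast hn
    rw [Real.le_log_iff_exp_le (by positivity), le_div_iff₀ hδ]
    nlinarith [Real.exp_pos 1]
  have hL1 : 1 ≤ L := hlog1.trans hLle
  -- the ball that contains the trajectories
  set R := 16 * D * F * T * ξ with hR
  have hR0 : 0 ≤ R := by positivity
  have hRm : R ≤ 16 * ξ * Real.sqrt m := by
    calc R = 16 * ξ * (D * F * T) := by rw [hR]; ring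
      _ ≤ _ := by gcongr
  have hQ : ∀ θ ∈ Metric.closedBall θ₀ R, ∀ x : X,
      ‖featureVec σ θ (x : Input d)‖ ≤ 34 * D * ξ := fun θ hθ x =>
    norm_featureVec_le_of_mem_closedBall hd1 hσ₁ hm hRm hθ (hX x x.2)
  have hdev := measure_exists_adjoint_featureOp_sub_avg_le ρ hσ hf θ₀ hR0 hF0
    (by positivity : 0 ≤ 34 * D * ξ) (Real.sqrt_nonneg κ) hres₀ hQ hκx hn hδ hδ1
  have hae : ∀ᵐ x ∂Measure.pi (fun _ : Fin n => ρ), ∀ i,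
      |network σ θ₀ (x i : Input d) - fstar (x i)| ≤ F := by
    rw [ae_all_iff]
    intro i
    exact (measurePreserving_eval (fun _ : Fin n => ρ) i).quasiMeasurePreserving.ae hres₀
  refine (measure_mono_ae ?_).trans hdev
  filter_upwards [hae] with x hx hbad hgood
  apply hbad
  intro θ hθ t ht htT
  -- This holds off a null set of samples and replaces the random ‖r̂_0‖ by F, so that a
  -- deterministic ball contains the trajectories.
  have hrF : Real.sqrt (empResidualSq σ fstar x θ₀) ≤ F := by
    refine Real.sqrt_le_iff.2 ⟨hF0, ?_⟩
    rw [empResidualSq, one_div, inv_mul_le_iff₀ hn']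
    calc _ ≤ ∑ _i : Fin n, F ^ 2 := Finset.sum_le_sum fun i _ => by
          rw [← sq_abs]; exact pow_le_pow_left₀ (abs_nonneg _) (hx i) 2
      _ = n * F ^ 2 := by simp
  subst hσ₁'
  exact hθ.residual_sub_exp_le ρ hσ hσ₁ hσ₂ hX hf hφ ht fun u hu =>
    hθ.norm_forcing_le ρ hσ hσ₁ hσ₂ hX hf hm hφ hF0 hT hκ0 hS hL1 (zero_le_one.trans hlog1) hLle hDFT hrF hgood hu htT
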